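/- Let $n\ge 2$, let $(\widetilde M,\widetilde g)$ be an $m$-dimensional Riemannian manifold of constant sectional curvature $c$ (a real space form $\widetilde M(c)$), and let $(M,g)$ be an $n$-dimensional Riemannian submanifold of $\widetilde M(c)$, that is, a Riemannian manifold with a smooth isometric immersion into $\widetilde M(c)$. Let $\sigma$ be its second fundamental form, $A_N$ its shape operators ($g(A_NX,Y)=\widetilde g(\sigma(X,Y),N)$), $R^\perp$ the curvature of its normal connection, and $\tau_{\rm Nor}(p)=\frac{2}{n(n-1)}\sum_{1\le i<j\le n}K(e_i\wedge e_j)$ its normalized scalar curvature, where $K$ is the sectional curvature of $(M,g)$ and $\{e_1,\dots,e_n\}$ is any orthonormal basis of $T_pM$. For a $k$-dimensional subspace $\Pi\subseteq T_pM$ with orthonormal basis $\{e_1,\dots,e_k\}$ put $\mathcal C(\Pi)=\frac1k\sum_{i,j=1}^k\|\sigma(e_i,e_j)\|^2$, let $\mathcal C_p=\mathcal C(T_pM)$, and let $$[\delta_{\mathcal C}(n-1)]_p=\tfrac12\,\mathcal C_p+\tfrac{n+1}{2n}\inf\{\mathcal C(\Pi):\Pi\text{ is a hyperplane of }T_pM\}.$$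 Then for all $p\in M$ $$\tau_{\rm Nor}(p)\le[\delta_{\mathcal C}(n-1)]_p+c .$$ Moreover, equality holds for all $p\in M$ if and only if $M$ is invariantly quasi-umbilical with trivial normal connection ($R^\perp=0$) and, at each point $p$, with respect to a suitable orthonormal basis $\{e_1,\dots,e_n\}$ of $T_pM$ and a suitable orthonormal basis $\{e_{n+1},\dots,e_m\}$ of the normal space $T_p^\perp M$, the shape operators $A_\alpha=A_{e_\alpha}$ have the form $$A_{n+1}=\operatorname{diag}(a,\dots,a,2a),\qquad A_{n+2}=\cdots=A_m=0$$ for some real number $a$ (depending on $p$). Here $M$ is invariantly quasi-umbilical if at each point there are $m-n$ mutually orthogonal unit normal vectors such that the corresponding shape operators all have an eigenvalue of multiplicity at least $n-1$ with the same distinguished eigendirection. (If $m=n$ there are no normal directions and the conditions on shape operators are void.) -/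

import Mathlib

open scoped Manifold ContDiff Topology InnerProductSpace

noncomputable section

namespace Casorati

/-! ### Riemannian geometry in coordinates

`E` and `E'` are coordinate spaces; a Riemannian metric in coordinates is a function `G` from
points to bilinear forms. -/

section Coordinates

variable {E E' : Type*} [NormedAddCommGroup E] [NormedSpace ℝ E]
  [NormedAddCommGroup E'] [NormedSpace ℝ E']

/-- The Levi-Civita connection of `G` in coordinates, `Γ(u, v) = ∇_u v` for constant `u, v`. It is
given by the Koszul formula `2 G(Γ(u, v), w) = u G(v, w) + v G(u, w) - w G(u, v)`; the map
`(G x).inverse`, from covectors to vectors, raises the index. -/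
def christoffel (G : E → E →L[ℝ] E →L[ℝ] ℝ) (x u v : E) : E :=
  (1 / 2 : ℝ) • (G x).inverse
    (fderiv ℝ G x u v + fderiv ℝ G x v u - ((fderiv ℝ G x).flip u).flip v)

lemma christoffel_add_left (G : E → E →L[ℝ] E →L[ℝ] ℝ) (x u u' v : E) :
    christoffel G x (u + u') v = christoffel G x u v + christoffel G x u' v := by
  simp only [christoffel, ← smul_add, ← map_add]
  congr 2
  refine ContinuousLinearMap.ext fun w => ?_
  simp
  ring

lemma christoffel_add_right (G : E → E →L[ℝ] E →L[ℝ] ℝ) (x u v v' : E) :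
    christoffel G x u (v + v') = christoffel G x u v + christoffel G x u v' := by
  simp only [christoffel, ← smul_add, ← map_add]
  congr 2
  refine ContinuousLinearMap.ext fun w => ?_
  simp
  ring

lemma christoffel_smul_left (G : E → E →L[ℝ] E →L[ℝ] ℝ) (a : ℝ) (x u v : E) :
    christoffel G x (a • u) v = a • christoffel G x u v := by
  simp only [christoffel, smul_comm a, ← ContinuousLinearMap.map_smul]
  refine congrArg (G x).inverse (ContinuousLinearMap.ext fun w => ?_)
  simp
  ring

lemma christoffel_smul_right (G : E → E →L[ℝ] E →L[ℝ] ℝ) (a : ℝ) (x u v : E) :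
    christoffel G x u (a • v) = a • christoffel G x u v := by
  simp only [christoffel, smul_comm a, ← ContinuousLinearMap.map_smul]
  refine congrArg (G x).inverse (ContinuousLinearMap.ext fun w => ?_)
  simp
  ring

/-- The covariant derivative `D_u V` at `x`, in the direction `u`, of a vector field `V` along a map
`F : E → E'`, for the Levi-Civita connection of the metric `G` on `E'`. -/
def covDerivAlong (G : E' → E' →L[ℝ] E' →L[ℝ] ℝ) (F : E → E') (u : E) (V : E → E') (x : E) : E' :=
  fderiv ℝ V x u + christoffel G (F x) (fderiv ℝ F x u) (V x)

/-- The covariant derivative `D_u (DF v) = D²F(u, v) + Γ(DF u, DF v)` at `x`, in the direction `u`,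
of the vector field `DF v` along `F`, as a bilinear map in `u` and `v`. -/
def hessianAlong (G : E' → E' →L[ℝ] E' →L[ℝ] ℝ) (F : E → E') (x : E) : E →ₗ[ℝ] E →ₗ[ℝ] E' :=
  LinearMap.mk₂ ℝ
    (fun u v => fderiv ℝ (fderiv ℝ F) x u v + christoffel G (F x) (fderiv ℝ F x u) (fderiv ℝ F x v))
    (fun u u' v => by simp [christoffel_add_left]; abel)
    (fun a u v => by simp [christoffel_smul_left])
    (fun u v v' => by simp [christoffel_add_right]; abel)
    (fun a u v => by simp [christoffel_smul_right])

lemma hessianAlong_eq (G : E' → E' →L[ℝ] E' →L[ℝ] ℝ) (F : E → E') (x u v : E)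
    (hF : DifferentiableAt ℝ (fderiv ℝ F) x) :
    hessianAlong G F x u v = covDerivAlong G F u (fun y => fderiv ℝ F y v) x := by
  simp [hessianAlong, covDerivAlong, fderiv_clm_apply hF (differentiableAt_const v)]

/-- The Riemann curvature `R(u, v) w = ∇_u ∇_v w - ∇_v ∇_u w` of `G` at `x`, where `u, v, w` are
extended to constant vector fields (so that `[u, v] = 0`). -/
def curvature (G : E → E →L[ℝ] E →L[ℝ] ℝ) (x u v w : E) : E :=
  covDerivAlong G id u (covDerivAlong G id v fun _ => w) x
    - covDerivAlong G id v (covDerivAlong G id u fun _ => w) x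

/-- The pullback at `x` of the metric `G` by `F`: the bilinear form `(u, v) ↦ G(DF u, DF v)`. -/
def pullbackMetric (G : E' → E' →L[ℝ] E' →L[ℝ] ℝ) (F : E → E') (x : E) : E →L[ℝ] E →L[ℝ] ℝ :=
  (G (F x)).bilinearComp (fderiv ℝ F x) (fderiv ℝ F x)

/-- The component of `w` which is `G`-orthogonal to the image of `DF` at `x`, that is
`w - ∑ gⁱʲ G(w, ∂ᵢF) ∂ⱼF`, where `g` is the pullback metric. -/
def normalPart (G : E' → E' →L[ℝ] E' →L[ℝ] ℝ) (F : E → E') (x : E) (w : E') : E' :=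
  w - fderiv ℝ F x ((pullbackMetric G F x).inverse ((G (F x) w).comp (fderiv ℝ F x)))

/-- The normal connection `∇^⊥_u V = (D_u V)^⊥` of `F`. -/
def normalDeriv (G : E' → E' →L[ℝ] E' →L[ℝ] ℝ) (F : E → E') (u : E) (V : E → E') (x : E) : E' :=
  normalPart G F x (covDerivAlong G F u V x)

/-- The normal curvature `R^⊥(u, v) V = ∇^⊥_u ∇^⊥_v V - ∇^⊥_v ∇^⊥_u V`, where `u, v` are extended
to constant vector fields (so that `[u, v] = 0`). -/
def normalCurvature (G : E' → E' →L[ℝ] E' →L[ℝ] ℝ) (F : E → E') (x u v : E) (V : E → E') : E' :=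
  normalDeriv G F u (normalDeriv G F v V) x - normalDeriv G F v (normalDeriv G F u V) x

end Coordinates

/-! ### Riemannian manifolds

The metric is the inner product which the Riemannian bundle structure puts on the tangent spaces.
Mathlib's tangent space at `x` *is* the coordinate space, a tangent vector being given by its
components in the preferred chart at `x` (Mathlib's lemma `mfderiv_extChartAt_self`). Hence formulas
in the preferred chart at `x` apply directly to tangent vectors at `x`. -/

section Instances

variable {n : ℕ} {M : Type*} [TopologicalSpace M] [ChartedSpace (EuclideanSpace ℝ (Fin n)) M]

instance (x : M) : FiniteDimensional ℝ (TangentSpace (𝓡 n) x) :=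
  inferInstanceAs (FiniteDimensional ℝ (EuclideanSpace ℝ (Fin n)))

/-! The next two instances are Mathlib's, for the tangent bundle only; this makes instance search
much faster than with the general ones. -/

open scoped Bundle in
instance tangentNormed [h : Bundle.RiemannianBundle (fun x : M => TangentSpace (𝓡 n) x)] (x : M) :
    NormedAddCommGroup (TangentSpace (𝓡 n) x) :=
  Bundle.instNormedAddCommGroupOfRiemannianBundleOfIsTopologicalAddGroupOfContinuousConstSMulReal
    (E := fun x : M => TangentSpace (𝓡 n) x) x

open scoped Bundle in
instance tangentInner [h : Bundle.RiemannianBundle (fun x : M => TangentSpace (𝓡 n) x)] (x : M) :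
    InnerProductSpace ℝ (TangentSpace (𝓡 n) x) :=
  Bundle.instInnerProductSpaceReal (E := fun x : M => TangentSpace (𝓡 n) x) x

end Instances

section Intrinsic

variable {n : ℕ} {M : Type*} [TopologicalSpace M] [ChartedSpace (EuclideanSpace ℝ (Fin n)) M]
  [Bundle.RiemannianBundle (fun x : M => TangentSpace (𝓡 n) x)]

variable (n) in
/-- The metric in the preferred chart at `x`, as a function on the coordinate space: the pullback
of the metric by the inverse chart. -/
def chartMetric (x : M) (y : EuclideanSpace ℝ (Fin n)) :
    EuclideanSpace ℝ (Fin n) →L[ℝ] EuclideanSpace ℝ (Fin n) →L[ℝ] ℝ :=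
  (innerSL ℝ (E := TangentSpace (𝓡 n) ((extChartAt (𝓡 n) x).symm y))).bilinearComp
    (mfderiv 𝓘(ℝ, EuclideanSpace ℝ (Fin n)) (𝓡 n) (extChartAt (𝓡 n) x).symm y)
    (mfderiv 𝓘(ℝ, EuclideanSpace ℝ (Fin n)) (𝓡 n) (extChartAt (𝓡 n) x).symm y)

variable (n) in
/-- The Riemann curvature operator `R(u, v) w` of the manifold at `x`. -/
def riemann (x : M) (u v w : TangentSpace (𝓡 n) x) : TangentSpace (𝓡 n) x :=
  curvature (chartMetric n x) (extChartAt (𝓡 n) x x) u v w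

variable (n) in
/-- `K(u ∧ v) = ⟨R(u, v) v, u⟩`, the sectional curvature of the plane spanned by `u` and `v`, for
orthonormal `u` and `v`. -/
def sectional (x : M) (u v : TangentSpace (𝓡 n) x) : ℝ :=
  ⟪riemann n x u v v, u⟫_ℝ

variable (n) in
/-- The scalar curvature `τ(x) = ∑_{i < j} K(eᵢ ∧ eⱼ)` for an orthonormal basis of the tangent
space; it does not depend on the basis. -/
def scalarCurvature (x : M) : ℝ :=
  let e := stdOrthonormalBasis ℝ (TangentSpace (𝓡 n) x)
  ∑ i, ∑ j, if i < j then sectional n x (e i) (e j) else 0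

variable (n) in
/-- The normalized scalar curvature `τ_Nor = 2 τ / (n (n - 1))`. -/
def normalizedScalarCurvature (x : M) : ℝ :=
  2 / ((n : ℝ) * (n - 1)) * scalarCurvature n x

variable (n M) in
/-- A real space form: all sectional curvatures are equal to `c`. -/
def IsRealSpaceForm (c : ℝ) : Prop :=
  ∀ (x : M) (u v : TangentSpace (𝓡 n) x), ‖u‖ = 1 → ‖v‖ = 1 → ⟪u, v⟫_ℝ = 0 → sectional n x u v = c

end Intrinsic

/-! ### Riemannian submanifolds -/

section Submanifold

variable {n m : ℕ}
  {M : Type*} [TopologicalSpace M] [ChartedSpace (EuclideanSpace ℝ (Fin n)) M]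
  [Bundle.RiemannianBundle (fun x : M => TangentSpace (𝓡 n) x)]
  {N : Type*} [TopologicalSpace N] [ChartedSpace (EuclideanSpace ℝ (Fin m)) N]
  [Bundle.RiemannianBundle (fun x : N => TangentSpace (𝓡 m) x)]

variable (n m) in
/-- `f` makes `M` a Riemannian submanifold of `N`: it is smooth and the metric of `M` is the one
induced by `f`. (In particular the differential of `f` is injective everywhere.) -/
structure IsIsometricImmersion (f : M → N) : Prop where
  smooth : ContMDiff (𝓡 n) (𝓡 m) ∞ f
  isometric : ∀ (p : M) (u v : TangentSpace (𝓡 n) p),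
    ⟪mfderiv (𝓡 n) (𝓡 m) f p u, mfderiv (𝓡 n) (𝓡 m) f p v⟫_ℝ = ⟪u, v⟫_ℝ

variable (n m) in
/-- The normal space `T_p^⊥ M`, a subspace of the tangent space of `N` at `f p`. -/
def normalSpace (f : M → N) (p : M) : Submodule ℝ (TangentSpace (𝓡 m) (f p)) :=
  (LinearMap.range (mfderiv (𝓡 n) (𝓡 m) f p).toLinearMap)ᗮ

variable (n m) in
/-- The map `f` in the preferred charts at `p` and at `f p`. -/
def localRep (f : M → N) (p : M) : EuclideanSpace ℝ (Fin n) → EuclideanSpace ℝ (Fin m) :=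
  writtenInExtChartAt (𝓡 n) (𝓡 m) p f

variable (n m) in
/-- The second fundamental form `σ(u, v) = (∇̃_u v)^⊥`, the normal component of the derivative of
(an extension of) `v` along `M` for the Levi-Civita connection of `N`. -/
def secondFundamentalForm (f : M → N) (p : M) :
    TangentSpace (𝓡 n) p →ₗ[ℝ] TangentSpace (𝓡 n) p →ₗ[ℝ] TangentSpace (𝓡 m) (f p) :=
  LinearMap.compr₂
    (show TangentSpace (𝓡 n) p →ₗ[ℝ] TangentSpace (𝓡 n) p →ₗ[ℝ] TangentSpace (𝓡 m) (f p) from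
      hessianAlong (chartMetric m (f p)) (localRep n m f p) (extChartAt (𝓡 n) p p))
    (normalSpace n m f p).starProjection.toLinearMap

variable (n m) in
/-- The shape operator `A_ν` in the direction of a normal vector `ν`, determined by
`⟨A_ν u, v⟩ = ⟨σ(u, v), ν⟩`. -/
def shapeOperator (f : M → N) (p : M) (ν : TangentSpace (𝓡 m) (f p)) :
    TangentSpace (𝓡 n) p →ₗ[ℝ] TangentSpace (𝓡 n) p where
  toFun u := LinearMap.adjoint (secondFundamentalForm n m f p u) ν
  map_add' u v := by simp
  map_smul' a u := by simp

lemma inner_shapeOperator (f : M → N) (p : M) (ν : TangentSpace (𝓡 m) (f p))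
    (u v : TangentSpace (𝓡 n) p) :
    ⟪shapeOperator n m f p ν u, v⟫_ℝ = ⟪secondFundamentalForm n m f p u v, ν⟫_ℝ := by
  simp [shapeOperator, LinearMap.adjoint_inner_left, real_inner_comm]

variable (n m) in
/-- The Casorati curvature `C(Π) = (1 / k) ∑_{i, j} ‖σ(eᵢ, eⱼ)‖²` of a `k`-dimensional subspace `Π`
of the tangent space, for an orthonormal basis of `Π`; it does not depend on the basis. -/
def casorati (f : M → N) (p : M) (W : Submodule ℝ (TangentSpace (𝓡 n) p)) : ℝ :=
  let e := stdOrthonormalBasis ℝ W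
  1 / (Module.finrank ℝ W : ℝ) * ∑ i, ∑ j, ‖secondFundamentalForm n m f p (e i) (e j)‖ ^ 2

variable (n m) in
/-- The normalized `δ`-Casorati curvature
`δ_C(n - 1) = C / 2 + (n + 1) / (2 n) inf {C(Π) : Π is a hyperplane}`, where `C` is the Casorati
curvature of the whole tangent space. -/
def deltaCasorati (f : M → N) (p : M) : ℝ :=
  1 / 2 * casorati n m f p ⊤ + ((n : ℝ) + 1) / (2 * n) *
    sInf {r | ∃ W : Submodule ℝ (TangentSpace (𝓡 n) p),
      Module.finrank ℝ W + 1 = n ∧ r = casorati n m f p W}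

variable (n m) in
/-- `p` is an invariantly quasi-umbilical point: for some orthonormal basis of normal vectors, all
the shape operators have an eigenvalue of multiplicity (at least) `n - 1`, with the same
distinguished eigendirection `d`. -/
def IsInvariantlyQuasiUmbilicalAt (f : M → N) (p : M) : Prop :=
  ∃ (ξ : Fin (m - n) → TangentSpace (𝓡 m) (f p)) (d : TangentSpace (𝓡 n) p),
    Orthonormal ℝ ξ ∧ (∀ α, ξ α ∈ normalSpace n m f p) ∧ ‖d‖ = 1 ∧
    ∀ α, ∃ a b : ℝ, shapeOperator n m f p (ξ α) d = b • d ∧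
      ∀ u : TangentSpace (𝓡 n) p, ⟪u, d⟫_ℝ = 0 → shapeOperator n m f p (ξ α) u = a • u

variable (n m) in
/-- `M` has trivial normal connection: the normal curvature `R^⊥(u, v) V` vanishes for all smooth
local normal vector fields `V`. Near each point, the field is written in the preferred charts. -/
def HasTrivialNormalConnection (f : M → N) : Prop :=
  ∀ (p : M) (u v : EuclideanSpace ℝ (Fin n))
    (V : EuclideanSpace ℝ (Fin n) → EuclideanSpace ℝ (Fin m)),
    ContDiffAt ℝ ∞ V (extChartAt (𝓡 n) p p) →
    (∀ᶠ y in 𝓝 (extChartAt (𝓡 n) p p), ∀ w : EuclideanSpace ℝ (Fin n),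
      chartMetric m (f p) (localRep n m f p y) (V y) (fderiv ℝ (localRep n m f p) y w) = 0) →
    normalCurvature (chartMetric m (f p)) (localRep n m f p) (extChartAt (𝓡 n) p p) u v V = 0

variable (n m) in
/-- For suitable orthonormal bases `e₁, …, eₙ` of the tangent space and `e_{n+1}, …, e_m` of the
normal space at `p`, the matrices of the shape operators are `A_{n+1} = diag(a, …, a, 2a)` and
`A_{n+2} = ⋯ = A_m = 0`. -/
def HasCasoratiIdealShape (f : M → N) (p : M) : Prop :=
  ∃ (e : OrthonormalBasis (Fin n) ℝ (TangentSpace (𝓡 n) p))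
    (ξ : Fin (m - n) → TangentSpace (𝓡 m) (f p)) (a : ℝ),
    Orthonormal ℝ ξ ∧ (∀ α, ξ α ∈ normalSpace n m f p) ∧
    ∀ α, LinearMap.toMatrix e.toBasis e.toBasis (shapeOperator n m f p (ξ α)) =
      if (α : ℕ) = 0 then Matrix.diagonal fun i : Fin n => if (i : ℕ) + 1 = n then 2 * a else a
      else 0

end Submanifold

end Casorati
end

/-! The Gauss equation in a space form, summed over an orthonormal basis, gives τ_Nor = c + (‖tr σ‖²
− ‖σ‖²) / (n(n − 1)) (`normalizedScalarCurvature_eq`). The inequality is therefore a statement about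
one symmetric bilinear map σ at one point.

Let P be a hyperplane with unit normal d, and replace the infimum by C(P). The right side minus the
left, multiplied by 2n(n − 1), is (n + 1)‖σ‖² + (n + 1)‖σ|P‖² − 2‖tr σ‖². With a = tr σ / (n + 1),
this equals n + 1 times a sum of squares (`casorati_identity`). The squares measure how far σ is
from diag(a, …, a, 2a), with d as last basis vector, so they all vanish exactly when σ(u, v) = (⟨u,
v⟩ + ⟨u, d⟩⟨v, d⟩) a for a normal vector a. The hyperplanes are parametrised by the compact unit
sphere, so the infimum is attained, and equality in the theorem is equality for some hyperplane
(`casorati_inequality`).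

For such σ the shape operator of ν is ⟨a, ν⟩(1 + d ⊗ d). A normal basis whose first vector points
along a gives the required matrices. Every normal direction has d as distinguished eigenvector. All
shape operators commute, so the Ricci equation in a space form gives R^⊥ = 0
(`IsIsometricAt.normalCurvature_eq_zero`).

The geometry is done in the preferred charts. Everything rests on three facts about the covariant
derivative along a map: it is metric (`fderiv_metric`), torsion-free (`covDerivAlong_fderiv_comm`),
and its commutator is the ambient curvature (`covDerivAlong_commutator`). The full tensor of a space
form is recovered from its sectional curvatures by polarisation (`curvature_of_constant`). -/

set_option maxSynthPendingDepth 3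
set_option linter.unusedSectionVars false

namespace Casorati

/-! ### The Levi-Civita connection in coordinates -/

section Coordinates

variable {E E' : Type*} [NormedAddCommGroup E] [NormedSpace ℝ E] [FiniteDimensional ℝ E]
  [NormedAddCommGroup E'] [NormedSpace ℝ E'] [FiniteDimensional ℝ E']

/-- `G` is a pseudo-Riemannian metric of class `C²` near `x`. -/
structure IsMetricAt (G : E → E →L[ℝ] E →L[ℝ] ℝ) (x : E) : Prop where
  contDiffAt : ContDiffAt ℝ 2 G x
  symm : ∀ y u v, G y u v = G y v u
  isInvertible : (G x).IsInvertible

/-- An injective map from E to its dual is bijective by dimension. This guarantees that `inverse`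
really raises indices and is not the default value 0. -/
lemma isInvertible_of_nondegenerate {B : E →L[ℝ] E →L[ℝ] ℝ} (hB : ∀ u, B u = 0 → u = 0) :
    B.IsInvertible := by
  have hinj : Function.Injective B.toLinearMap := by
    rw [← LinearMap.ker_eq_bot, LinearMap.ker_eq_bot']
    exact hB
  have hdim : Module.finrank ℝ E = Module.finrank ℝ (E →L[ℝ] ℝ) := by
    rw [← (LinearMap.toContinuousLinearMap (𝕜 := ℝ) (E := E) (F' := ℝ)).finrank_eq]
    exact (Subspace.dual_finrank_eq (K := ℝ) (V := E)).symm
  exact ⟨(LinearEquiv.ofInjectiveOfFinrankEq B.toLinearMap hinj hdim).toContinuousLinearEquiv,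
    by ext; rfl⟩

namespace IsMetricAt

variable {G : E → E →L[ℝ] E →L[ℝ] ℝ} {x : E}

/-- Invertibility is an open condition. Identities proved at a point thus hold nearby and can be
differentiated. -/
lemma eventually (hG : IsMetricAt G x) : ∀ᶠ y in 𝓝 x, IsMetricAt G y := by
  obtain ⟨e, he⟩ := hG.isInvertible
  have h : ∀ᶠ B in 𝓝 (G x), B.IsInvertible := by
    filter_upwards [he ▸ e.nhds] with B hB using hB
  filter_upwards [hG.contDiffAt.eventually (by simp), hG.contDiffAt.continuousAt.eventually h]
    with y h1 h2 using ⟨h1, hG.symm, h2⟩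

lemma differentiableAt (hG : IsMetricAt G x) : DifferentiableAt ℝ G x :=
  hG.contDiffAt.differentiableAt (by norm_num)

lemma eq_of_forall (hG : IsMetricAt G x) {u v : E} (h : ∀ w, G x u w = G x v w) : u = v :=
  hG.isInvertible.injective (ContinuousLinearMap.ext h)

lemma fderiv_symm (hG : IsMetricAt G x) (a u v : E) :
    fderiv ℝ G x a u v = fderiv ℝ G x a v u := by
  have key (u v : E) : fderiv ℝ (fun y => G y u v) x a = fderiv ℝ G x a u v := by
    have := (hG.differentiableAt.hasFDerivAt.clm_apply (hasFDerivAt_const u x)).clm_apply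
      (hasFDerivAt_const v x)
    rw [this.fderiv]
    simp
  rw [← key, ← key]
  simp_rw [hG.symm _ u v]

/-- The Koszul formula, with the raised index lowered again. Later computations use this form and
avoid the inverse. -/
lemma two_mul_inner_christoffel (hG : IsMetricAt G x) (u v w : E) :
    2 * G x (christoffel G x u v) w =
      fderiv ℝ G x u v w + fderiv ℝ G x v u w - fderiv ℝ G x w u v := by
  simp [christoffel, hG.isInvertible.self_apply_inverse]

lemma christoffel_symm (hG : IsMetricAt G x) (u v : E) :
    christoffel G x u v = christoffel G x v u := by
  refine hG.eq_of_forall fun w => ?_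
  have h1 := hG.two_mul_inner_christoffel u v w
  have h2 := hG.two_mul_inner_christoffel v u w
  have h3 := hG.fderiv_symm w u v
  linarith

end IsMetricAt

/-- The Christoffel symbols as a field of continuous bilinear maps. -/
noncomputable def christoffelCLM (G : E → E →L[ℝ] E →L[ℝ] ℝ) (x : E) : E →L[ℝ] E →L[ℝ] E :=
  (1 / 2 : ℝ) • (ContinuousLinearMap.compL ℝ E (E →L[ℝ] ℝ) E (G x).inverse).comp
    (fderiv ℝ G x + (fderiv ℝ G x).flip
      - ((ContinuousLinearMap.flipₗᵢ ℝ E E ℝ).toContinuousLinearEquiv :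
          (E →L[ℝ] E →L[ℝ] ℝ) →L[ℝ] (E →L[ℝ] E →L[ℝ] ℝ)).comp (fderiv ℝ G x).flip)

lemma christoffelCLM_apply (G : E → E →L[ℝ] E →L[ℝ] ℝ) (x u v : E) :
    christoffelCLM G x u v = christoffel G x u v := by
  simp [christoffelCLM, christoffel]

/-- Inversion is smooth at invertible maps and one derivative of `G` is taken, so a C² metric gives
C¹ symbols, which is just enough to define curvature. -/
lemma IsMetricAt.contDiffAt_christoffelCLM {G : E → E →L[ℝ] E →L[ℝ] ℝ} {x : E}
    (hG : IsMetricAt G x) : ContDiffAt ℝ 1 (christoffelCLM G) x := by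
  have hinv : ContDiffAt ℝ 1 (fun y => (G y).inverse) x :=
    (hG.isInvertible.contDiffAt_map_inverse).comp x (hG.contDiffAt.of_le (by norm_num))
  have hd : ContDiffAt ℝ 1 (fderiv ℝ G) x := hG.contDiffAt.fderiv_right (by norm_num)
  have hf : ContDiffAt ℝ 1 (fun y => (fderiv ℝ G y).flip) x :=
    (ContinuousLinearMap.flipₗᵢ ℝ E E (E →L[ℝ] ℝ)).contDiff.contDiffAt.comp x hd
  have hc : ContDiffAt ℝ 1
      (fun y => ContinuousLinearMap.compL ℝ E (E →L[ℝ] ℝ) E (G y).inverse) x :=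
    (ContinuousLinearMap.compL ℝ E (E →L[ℝ] ℝ) E).contDiff.contDiffAt.comp x hinv
  exact ContDiffAt.const_smul (1 / 2 : ℝ) (hc.clm_comp ((hd.add hf).sub (contDiffAt_const.clm_comp hf)))

variable {G : E' → E' →L[ℝ] E' →L[ℝ] ℝ} {F : E → E'} {V W : E → E'} {x : E}

lemma covDerivAlong_apply (G : E' → E' →L[ℝ] E' →L[ℝ] ℝ) (F : E → E') (u : E) (V : E → E') (x : E) :
    covDerivAlong G F u V x = fderiv ℝ V x u + christoffel G (F x) (fderiv ℝ F x u) (V x) := rfl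

lemma covDerivAlong_eq (G : E' → E' →L[ℝ] E' →L[ℝ] ℝ) (F : E → E') (u : E) (V : E → E') :
    covDerivAlong G F u V =
      fun x => fderiv ℝ V x u + christoffelCLM G (F x) (fderiv ℝ F x u) (V x) := by
  funext x
  simp [covDerivAlong, christoffelCLM_apply]

lemma contDiffAt_covDerivAlong (hG : IsMetricAt G (F x)) (hF : ContDiffAt ℝ 2 F x)
    (hV : ContDiffAt ℝ 2 V x) (u : E) : ContDiffAt ℝ 1 (covDerivAlong G F u V) x := by
  rw [covDerivAlong_eq]
  refine ((hV.fderiv_right (by norm_num)).clm_apply contDiffAt_const).add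
    (((hG.contDiffAt_christoffelCLM.comp x (hF.of_le (by norm_num))).clm_apply
      ((hF.fderiv_right (by norm_num)).clm_apply contDiffAt_const)).clm_apply
      (hV.of_le (by norm_num)))

lemma covDerivAlong_congr {V' : E → E'} (h : V =ᶠ[𝓝 x] V') (u : E) :
    covDerivAlong G F u V x = covDerivAlong G F u V' x := by
  simp [covDerivAlong, h.fderiv_eq, h.self_of_nhds]

lemma covDerivAlong_sub (hV : DifferentiableAt ℝ V x) (hW : DifferentiableAt ℝ W x) (u : E) :
    covDerivAlong G F u (fun y => V y - W y) x
      = covDerivAlong G F u V x - covDerivAlong G F u W x := by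
  simp only [covDerivAlong_eq]
  rw [fderiv_fun_sub hV hW]
  simp
  abel

/-- The connection is compatible with the metric. -/
lemma fderiv_metric (hG : IsMetricAt G (F x)) (hF : DifferentiableAt ℝ F x)
    (hV : DifferentiableAt ℝ V x) (hW : DifferentiableAt ℝ W x) (u : E) :
    fderiv ℝ (fun y => G (F y) (V y) (W y)) x u =
      G (F x) (covDerivAlong G F u V x) (W x) + G (F x) (V x) (covDerivAlong G F u W x) := by
  have h := ((hG.differentiableAt.hasFDerivAt.comp x hF.hasFDerivAt).clm_apply
    hV.hasFDerivAt).clm_apply hW.hasFDerivAt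
  have h' : fderiv ℝ (fun y => G (F y) (V y) (W y)) x = _ := h.fderiv
  rw [h']
  have h1 := hG.two_mul_inner_christoffel (fderiv ℝ F x u) (V x) (W x)
  have h2 := hG.two_mul_inner_christoffel (fderiv ℝ F x u) (W x) (V x)
  have h3 := hG.fderiv_symm (fderiv ℝ F x u) (V x) (W x)
  have h4 := hG.fderiv_symm (V x) (fderiv ℝ F x u) (W x)
  have h5 := hG.symm (F x) (V x) (christoffel G (F x) (fderiv ℝ F x u) (W x))
  have h6 := hG.fderiv_symm (W x) (fderiv ℝ F x u) (V x)
  simp only [covDerivAlong, map_add, add_apply]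
  simp
  linarith

/-- The connection is torsion-free. -/
lemma covDerivAlong_fderiv_comm (hG : IsMetricAt G (F x)) (hF : ContDiffAt ℝ 2 F x) (u v : E) :
    covDerivAlong G F u (fun y => fderiv ℝ F y v) x
      = covDerivAlong G F v (fun y => fderiv ℝ F y u) x := by
  have hd : DifferentiableAt ℝ (fderiv ℝ F) x :=
    (hF.fderiv_right (m := 1) (by norm_num)).differentiableAt (by norm_num)
  have hs : fderiv ℝ (fderiv ℝ F) x u v = fderiv ℝ (fderiv ℝ F) x v u :=
    (hF.isSymmSndFDerivAt (by simp)) u v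
  rw [← hessianAlong_eq _ _ _ _ _ hd, ← hessianAlong_eq _ _ _ _ _ hd]
  simp [hessianAlong, hs, hG.christoffel_symm (fderiv ℝ F x u)]

lemma hessianAlong_symm (hG : IsMetricAt G (F x)) (hF : ContDiffAt ℝ 2 F x) (u v : E) :
    hessianAlong G F x u v = hessianAlong G F x v u := by
  have hd : DifferentiableAt ℝ (fderiv ℝ F) x :=
    (hF.fderiv_right (m := 1) (by norm_num)).differentiableAt (by norm_num)
  rw [hessianAlong_eq _ _ _ _ _ hd, hessianAlong_eq _ _ _ _ _ hd, covDerivAlong_fderiv_comm hG hF]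

/-! ### The curvature tensor -/

lemma fderiv_covDerivAlong (hG : IsMetricAt G (F x)) (hF : ContDiffAt ℝ 2 F x)
    (hV : ContDiffAt ℝ 2 V x) (u v : E) :
    fderiv ℝ (covDerivAlong G F v V) x u =
      fderiv ℝ (fderiv ℝ V) x u v
        + (fderiv ℝ (christoffelCLM G) (F x) (fderiv ℝ F x u) (fderiv ℝ F x v) (V x)
          + christoffelCLM G (F x) (fderiv ℝ (fderiv ℝ F) x u v) (V x)
          + christoffelCLM G (F x) (fderiv ℝ F x v) (fderiv ℝ V x u)) := by
  have hF1 : HasFDerivAt F (fderiv ℝ F x) x := (hF.differentiableAt (by norm_num)).hasFDerivAt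
  have hV1 : HasFDerivAt V (fderiv ℝ V x) x := (hV.differentiableAt (by norm_num)).hasFDerivAt
  have hF2 : HasFDerivAt (fderiv ℝ F) (fderiv ℝ (fderiv ℝ F) x) x :=
    ((hF.fderiv_right (m := 1) (by norm_num)).differentiableAt (by norm_num)).hasFDerivAt
  have hV2 : HasFDerivAt (fderiv ℝ V) (fderiv ℝ (fderiv ℝ V) x) x :=
    ((hV.fderiv_right (m := 1) (by norm_num)).differentiableAt (by norm_num)).hasFDerivAt
  have hΓ : HasFDerivAt (christoffelCLM G) (fderiv ℝ (christoffelCLM G) (F x)) (F x) :=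
    (hG.contDiffAt_christoffelCLM.differentiableAt (by norm_num)).hasFDerivAt
  rw [covDerivAlong_eq]
  have h := (hV2.clm_apply (hasFDerivAt_const v x)).add
    (((hΓ.comp x hF1).clm_apply (hF2.clm_apply (hasFDerivAt_const v x))).clm_apply hV1)
  have h' : fderiv ℝ (fun x => fderiv ℝ V x v + christoffelCLM G (F x) (fderiv ℝ F x v) (V x)) x
    = _ := h.fderiv
  rw [h']
  simp
  abel

/-- The case `F = id` with a constant field: second derivatives drop out and the classical ∂Γ + ΓΓ
expression remains. -/
lemma curvature_eq {x : E'} (hG : IsMetricAt G x) (u v w : E') :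
    curvature G x u v w =
      fderiv ℝ (christoffelCLM G) x u v w + christoffelCLM G x u (christoffelCLM G x v w)
      - (fderiv ℝ (christoffelCLM G) x v u w + christoffelCLM G x v (christoffelCLM G x u w)) := by
  have h (u v : E') := fderiv_covDerivAlong (F := id) (V := fun _ => w) (x := x) hG contDiffAt_id
    contDiffAt_const u v
  have hid : fderiv ℝ (fderiv ℝ (id : E' → E')) x = 0 := by
    have : fderiv ℝ (id : E' → E') = fun _ => ContinuousLinearMap.id ℝ E' := by
      funext y; simp
    rw [this]; simp
  rw [curvature, covDerivAlong_apply G id u (covDerivAlong G id v _),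
    covDerivAlong_apply G id v (covDerivAlong G id u _), h u v, h v u]
  simp [hid, ← christoffelCLM_apply, covDerivAlong]

/-- The commutator of covariant derivatives along a map is given by the curvature. -/
lemma covDerivAlong_commutator (hG : IsMetricAt G (F x)) (hF : ContDiffAt ℝ 2 F x)
    (hV : ContDiffAt ℝ 2 V x) (u v : E) :
    covDerivAlong G F u (covDerivAlong G F v V) x - covDerivAlong G F v (covDerivAlong G F u V) x
      = curvature G (F x) (fderiv ℝ F x u) (fderiv ℝ F x v) (V x) := by
  have hs : fderiv ℝ (fderiv ℝ F) x u v = fderiv ℝ (fderiv ℝ F) x v u :=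
    (hF.isSymmSndFDerivAt (by simp)) u v
  have hs' : fderiv ℝ (fderiv ℝ V) x u v = fderiv ℝ (fderiv ℝ V) x v u :=
    (hV.isSymmSndFDerivAt (by simp)) u v
  rw [curvature_eq hG, covDerivAlong_apply G F u (covDerivAlong G F v V),
    covDerivAlong_apply G F v (covDerivAlong G F u V), fderiv_covDerivAlong hG hF hV u v,
    fderiv_covDerivAlong hG hF hV v u, hs, hs']
  simp only [← christoffelCLM_apply, covDerivAlong, map_add]
  abel

/-! ### Algebraic symmetries of the curvature. -/

section Symmetries

variable {x : E'}

lemma curvature_add_left (hG : IsMetricAt G x) (u u' v w : E') :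
    curvature G x (u + u') v w = curvature G x u v w + curvature G x u' v w := by
  simp only [curvature_eq hG, map_add, add_apply]
  abel

lemma curvature_smul_left (hG : IsMetricAt G x) (a : ℝ) (u v w : E') :
    curvature G x (a • u) v w = a • curvature G x u v w := by
  simp only [curvature_eq hG, map_smul, smul_apply, smul_sub, smul_add]

lemma curvature_swap (u v w : E') : curvature G x u v w = -curvature G x v u w := by
  simp [curvature]

/-- Γ is symmetric throughout a neighbourhood, so its derivative is symmetric too. In the cyclic sum
the ∂Γ terms and the ΓΓ terms then cancel in pairs. -/
lemma curvature_bianchi (hG : IsMetricAt G x) (u v w : E') :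
    curvature G x u v w + curvature G x v w u + curvature G x w u v = 0 := by
  have hsymm : ∀ᶠ y in 𝓝 x, ∀ a b, christoffelCLM G y a b = christoffelCLM G y b a := by
    filter_upwards [hG.eventually] with y hy a b
    rw [christoffelCLM_apply, christoffelCLM_apply, hy.christoffel_symm]
  have hd : DifferentiableAt ℝ (christoffelCLM G) x :=
    hG.contDiffAt_christoffelCLM.differentiableAt (by norm_num)
  have hsymm' (c a b : E') :
      fderiv ℝ (christoffelCLM G) x c a b = fderiv ℝ (christoffelCLM G) x c b a := by
    have key (a b : E') : fderiv ℝ (fun y => christoffelCLM G y a b) x c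
        = fderiv ℝ (christoffelCLM G) x c a b := by
      rw [((hd.hasFDerivAt.clm_apply (hasFDerivAt_const a x)).clm_apply
        (hasFDerivAt_const b x)).fderiv]
      simp
    rw [← key, ← key, Filter.EventuallyEq.fderiv_eq (hsymm.mono fun y hy => hy a b)]
  rw [curvature_eq hG, curvature_eq hG, curvature_eq hG, hsymm' u v w, hsymm' v w u, hsymm' w u v,
    hsymm.self_of_nhds v w, hsymm.self_of_nhds w u, hsymm.self_of_nhds u v]
  abel

end Symmetries

/-- Second derivatives of an inner product in terms of covariant derivatives. -/
lemma fderiv_fderiv_metric (hG : IsMetricAt G (F x)) (hF : ContDiffAt ℝ 2 F x)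
    (hV : ContDiffAt ℝ 2 V x) (hW : ContDiffAt ℝ 2 W x) (u v : E) :
    fderiv ℝ (fun y => fderiv ℝ (fun z => G (F z) (V z) (W z)) y v) x u =
      G (F x) (covDerivAlong G F u (covDerivAlong G F v V) x) (W x)
      + G (F x) (covDerivAlong G F v V x) (covDerivAlong G F u W x)
      + (G (F x) (covDerivAlong G F u V x) (covDerivAlong G F v W x)
      + G (F x) (V x) (covDerivAlong G F u (covDerivAlong G F v W) x)) := by
  have hev : (fun y => fderiv ℝ (fun z => G (F z) (V z) (W z)) y v) =ᶠ[𝓝 x]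
      fun y => G (F y) (covDerivAlong G F v V y) (W y)
        + G (F y) (V y) (covDerivAlong G F v W y) := by
    filter_upwards [hF.continuousAt.eventually hG.eventually, hF.eventually (by simp),
      hV.eventually (by simp), hW.eventually (by simp)] with y h1 h2 h3 h4
    exact fderiv_metric h1 (h2.differentiableAt (by norm_num)) (h3.differentiableAt (by norm_num))
      (h4.differentiableAt (by norm_num)) v
  have hF1 : DifferentiableAt ℝ F x := hF.differentiableAt (by norm_num)
  have hV1 : DifferentiableAt ℝ V x := hV.differentiableAt (by norm_num)
  have hW1 : DifferentiableAt ℝ W x := hW.differentiableAt (by norm_num)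
  have hDV : DifferentiableAt ℝ (covDerivAlong G F v V) x :=
    (contDiffAt_covDerivAlong hG hF hV v).differentiableAt (by norm_num)
  have hDW : DifferentiableAt ℝ (covDerivAlong G F v W) x :=
    (contDiffAt_covDerivAlong hG hF hW v).differentiableAt (by norm_num)
  have hG1 : DifferentiableAt ℝ (fun y => G (F y)) x := hG.differentiableAt.comp x hF1
  rw [hev.fderiv_eq, fderiv_fun_add ((hG1.clm_apply hDV).clm_apply hW1)
    ((hG1.clm_apply hV1).clm_apply hDW), add_apply,
    fderiv_metric hG hF1 hDV hW1, fderiv_metric hG hF1 hV1 hDW]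

/-- Second derivatives of the function G(w, z) commute. Expanded by metric compatibility, the mixed
terms are symmetric in u and v and cancel, leaving G(R w, z) + G(w, R z) = 0. -/
lemma curvature_skew {x : E'} (hG : IsMetricAt G x) (u v w z : E') :
    G x (curvature G x u v w) z = -G x (curvature G x u v z) w := by
  have hid : ContDiffAt ℝ 2 (id : E' → E') x := contDiffAt_id
  have h (u v : E') := fderiv_fderiv_metric (F := id) hG hid
    (contDiffAt_const (c := w)) (contDiffAt_const (c := z)) u v
  have hsm : ContDiffAt ℝ 2 (fun y => G y w z) x :=
    (hG.contDiffAt.clm_apply contDiffAt_const).clm_apply contDiffAt_const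
  have hd : DifferentiableAt ℝ (fderiv ℝ (fun y => G y w z)) x :=
    (hsm.fderiv_right (m := 1) (by norm_num)).differentiableAt (by norm_num)
  have hs : fderiv ℝ (fun y => fderiv ℝ (fun y => G y w z) y v) x u
      = fderiv ℝ (fun y => fderiv ℝ (fun y => G y w z) y u) x v := by
    rw [(hd.hasFDerivAt.clm_apply (hasFDerivAt_const v x)).fderiv,
      (hd.hasFDerivAt.clm_apply (hasFDerivAt_const u x)).fderiv]
    simpa using (hsm.isSymmSndFDerivAt (by simp)) u v
  have e := (h u v).symm.trans (hs.trans (h v u))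
  have s := hG.symm x
  simp only [id] at e
  simp only [curvature, map_sub, sub_apply]
  rw [s _ w, s _ w]
  linarith

end Coordinates

/-! ### Curvature tensors with constant sectional curvature -/

section CurvatureLike

variable {E : Type*} [AddCommGroup E] [Module ℝ E]

/-- A map with the algebraic symmetries of the Riemann curvature tensor. -/
structure IsCurvatureLike (S : E → E → E → E → ℝ) : Prop where
  add_left : ∀ u u' v w z, S (u + u') v w z = S u v w z + S u' v w z
  smul_left : ∀ (a : ℝ) u v w z, S (a • u) v w z = a * S u v w z
  swap : ∀ u v w z, S u v w z = -S v u w z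
  skew : ∀ u v w z, S u v w z = -S u v z w
  bianchi : ∀ u v w z, S u v w z + S v w u z + S w u v z = 0

namespace IsCurvatureLike

variable {S : E → E → E → E → ℝ}

/-- The octahedron argument: four instances of the Bianchi identity, combined with the two
skew-symmetries. -/
lemma pair_symm (hS : IsCurvatureLike S) (u v w z : E) : S u v w z = S w z u v := by
  linarith [hS.bianchi u v w z, hS.bianchi v w z u, hS.bianchi w z u v, hS.bianchi z u v w,
    hS.swap v w u z, hS.swap w u v z, hS.skew u v w z, hS.skew w z u v, hS.skew v w z u,
    hS.skew z u v w, hS.swap u v w z, hS.skew w u v z, hS.skew z v w u, hS.swap z u w v,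
    hS.skew u w z v, hS.swap u w z v, hS.swap v z u w, hS.skew z v u w, hS.skew v z u w,
    hS.swap w z u v, hS.skew z w u v, hS.swap z u v w, hS.skew u z w v, hS.skew v w u z]

lemma add_mid (hS : IsCurvatureLike S) (u v v' w z : E) :
    S u (v + v') w z = S u v w z + S u v' w z := by
  rw [hS.swap, hS.add_left, hS.swap v, hS.swap v']; ring

lemma smul_mid (hS : IsCurvatureLike S) (a : ℝ) (u v w z : E) :
    S u (a • v) w z = a * S u v w z := by
  rw [hS.swap, hS.smul_left, hS.swap v]; ring

lemma add_third (hS : IsCurvatureLike S) (u v w w' z : E) :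
    S u v (w + w') z = S u v w z + S u v w' z := by
  rw [hS.pair_symm, hS.add_left, hS.pair_symm w, hS.pair_symm w']

lemma smul_third (hS : IsCurvatureLike S) (a : ℝ) (u v w z : E) :
    S u v (a • w) z = a * S u v w z := by
  rw [hS.pair_symm, hS.smul_left, hS.pair_symm w]

lemma add_right (hS : IsCurvatureLike S) (u v w z z' : E) :
    S u v w (z + z') = S u v w z + S u v w z' := by
  rw [hS.pair_symm, hS.add_mid, hS.pair_symm w, hS.pair_symm w]

lemma smul_right (hS : IsCurvatureLike S) (a : ℝ) (u v w z : E) :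
    S u v w (a • z) = a * S u v w z := by
  rw [hS.pair_symm, hS.smul_mid, hS.pair_symm w]

/-- A curvature tensor is determined by its sectional curvatures. -/
lemma eq_zero (hS : IsCurvatureLike S) (h : ∀ u v, S u v v u = 0) (u v w z : E) :
    S u v w z = 0 := by
  -- Polarising in the outer slots, then in the middle ones (`h2`), makes S alternating in its first
  -- three arguments. The three Bianchi terms then coincide, so 3S = 0.
  have h1 (u v z : E) : S u v v z = 0 := by
    have := h (u + z) v
    rw [hS.add_left, hS.add_right, hS.add_right, h, h] at this
    have e1 := hS.pair_symm z v v u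
    have e2 := hS.swap v u z v
    have e3 := hS.skew u v z v
    linarith
  have h2 (u v w z : E) : S u v w z = -S u w v z := by
    have := h1 u (v + w) z
    rw [hS.add_mid, hS.add_third, hS.add_third, h1, h1] at this
    linarith
  linarith [hS.bianchi u v w z, h2 u v w z, hS.swap u w v z, hS.swap v w u z, h2 w v u z,
    hS.swap w v u z, h2 v w u z, hS.swap v u w z]

lemma eq_zero_of_orthonormal (hS : IsCurvatureLike S) (B : E →ₗ[ℝ] E →ₗ[ℝ] ℝ)
    (hpos : ∀ u, u ≠ 0 → 0 < B u u)
    (h : ∀ u v, B u u = 1 → B v v = 1 → B u v = 0 → S u v v u = 0) (u v w z : E) :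
    S u v w z = 0 := by
  have hzero (w z : E) : S 0 v w z = 0 := by simpa using hS.smul_left 0 0 v w z
  have horth (u v : E) (huv : B u v = 0) : S u v v u = 0 := by
    by_cases hu : u = 0
    · subst hu; simpa using hS.smul_left 0 0 v v 0
    by_cases hv : v = 0
    · subst hv; simpa using hS.smul_mid 0 u 0 0 u
    have hn (u : E) (hu : u ≠ 0) : ∃ r : ℝ, r ≠ 0 ∧ B (r • u) (r • u) = 1 := by
      have hp := hpos u hu
      have hs := Real.sqrt_pos.2 hp
      refine ⟨(√(B u u))⁻¹, inv_ne_zero hs.ne', ?_⟩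
      have := Real.mul_self_sqrt hp.le
      simp only [map_smul, LinearMap.smul_apply, smul_eq_mul]
      field_simp
      nlinarith
    obtain ⟨r, hr, hr'⟩ := hn u hu
    obtain ⟨s, hs, hs'⟩ := hn v hv
    have := h (r • u) (s • v) hr' hs' (by simp [huv])
    rw [hS.smul_left, hS.smul_mid, hS.smul_third, hS.smul_right] at this
    simpa [hr, hs] using this
  refine hS.eq_zero (fun u v => ?_) u v w z
  by_cases hv : v = 0
  · subst hv; simpa using hS.smul_mid 0 u 0 0 u
  have hp := hpos v hv
  have hself (w z : E) : S v v w z = 0 := by linarith [hS.swap v v w z]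
  have hself' (u w : E) : S u w v v = 0 := by linarith [hS.skew u w v v]
  -- Gram–Schmidt: removing from u its component along v does not change S u v v u, since terms with
  -- v repeated in the first or last pair vanish.
  have := horth (u + (-(B u v / B v v)) • v) v (by
    simp only [map_add, map_smul, LinearMap.add_apply, LinearMap.smul_apply, smul_eq_mul]
    field_simp
    ring)
  rw [hS.add_left, hS.add_right, hS.add_right, hS.smul_left, hS.smul_left, hS.smul_right, hself,
    hself, hself'] at this
  linarith

end IsCurvatureLike

end CurvatureLike

section Coordinates

variable {E E' : Type*} [NormedAddCommGroup E] [NormedSpace ℝ E] [FiniteDimensional ℝ E]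
  [NormedAddCommGroup E'] [NormedSpace ℝ E'] [FiniteDimensional ℝ E']

/-- The curvature tensor of a metric with constant sectional curvature. -/
lemma curvature_of_constant {G : E → E →L[ℝ] E →L[ℝ] ℝ} {x : E} {c : ℝ} (hG : IsMetricAt G x)
    (hpos : ∀ u, u ≠ 0 → 0 < G x u u)
    (hc : ∀ u v, G x u u = 1 → G x v v = 1 → G x u v = 0 → G x (curvature G x u v v) u = c)
    (u v w z : E) :
    G x (curvature G x u v w) z = c * (G x v w * G x u z - G x u w * G x v z) := by
  have s := hG.symm x
  have hS : IsCurvatureLike fun u v w z =>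
      G x (curvature G x u v w) z - c * (G x v w * G x u z - G x u w * G x v z) := by
    constructor
    · intro u u' v w z
      simp only [curvature_add_left hG, map_add, add_apply]
      ring
    · intro a u v w z
      simp only [curvature_smul_left hG, map_smul, smul_apply, smul_eq_mul]
      ring
    · intro u v w z
      rw [curvature_swap]
      simp only [map_neg, neg_apply]
      ring
    · intro u v w z
      rw [curvature_skew hG]
      ring
    · intro u v w z
      have h := congrArg (fun a => G x a z) (curvature_bianchi hG u v w)
      simp only [map_add, add_apply, map_zero, zero_apply] at h
      linear_combination h + c * G x u z * (s w v) + c * G x v z * (s u w) + c * G x w z * (s v u)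
  have := hS.eq_zero_of_orthonormal (LinearMap.mk₂ ℝ (fun u v => G x u v) (by simp) (by simp)
    (by simp) (by simp)) hpos (fun u v hu hv huv => by
      simp only [LinearMap.mk₂_apply] at hu hv huv
      simp only [hc u v hu hv huv, hu, hv, huv, s v u]
      ring) u v w z
  linarith

/-! ### The equations of Gauss and Ricci -/

/-- `F` is an isometric immersion of class `C³` near `x`, from the metric `g` to the metric `G`. -/
structure IsIsometricAt (G : E' → E' →L[ℝ] E' →L[ℝ] ℝ) (g : E → E →L[ℝ] E →L[ℝ] ℝ) (F : E → E')
    (x : E) : Prop where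
  target : IsMetricAt G (F x)
  source : IsMetricAt g x
  contDiffAt : ContDiffAt ℝ 3 F x
  isometric : ∀ᶠ y in 𝓝 x, ∀ u v, G (F y) (fderiv ℝ F y u) (fderiv ℝ F y v) = g y u v

variable {G : E' → E' →L[ℝ] E' →L[ℝ] ℝ} {g : E → E →L[ℝ] E →L[ℝ] ℝ} {F : E → E'} {x : E}

namespace IsIsometricAt

lemma eventually (h : IsIsometricAt G g F x) : ∀ᶠ y in 𝓝 x, IsIsometricAt G g F y := by
  filter_upwards [h.contDiffAt.continuousAt.eventually h.target.eventually, h.source.eventually,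
    h.contDiffAt.eventually (by simp), h.isometric.eventually_nhds] with y h1 h2 h3 h4
    using ⟨h1, h2, h3, h4⟩

lemma contDiffAt_two (h : IsIsometricAt G g F x) : ContDiffAt ℝ 2 F x :=
  h.contDiffAt.of_le (by norm_num)

lemma contDiffAt_fderiv (h : IsIsometricAt G g F x) : ContDiffAt ℝ 2 (fderiv ℝ F) x :=
  h.contDiffAt.fderiv_right (by norm_num)

lemma contDiffAt_fderiv_apply (h : IsIsometricAt G g F x) (v : E) :
    ContDiffAt ℝ 2 (fun y => fderiv ℝ F y v) x :=
  h.contDiffAt_fderiv.clm_apply contDiffAt_const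

lemma differentiableAt (h : IsIsometricAt G g F x) : DifferentiableAt ℝ F x :=
  h.contDiffAt.differentiableAt (by norm_num)

lemma differentiableAt_fderiv (h : IsIsometricAt G g F x) : DifferentiableAt ℝ (fderiv ℝ F) x :=
  h.contDiffAt_fderiv.differentiableAt (by norm_num)

lemma differentiableAt_fderiv_apply (h : IsIsometricAt G g F x) (v : E) :
    DifferentiableAt ℝ (fun y => fderiv ℝ F y v) x :=
  (h.contDiffAt_fderiv_apply v).differentiableAt (by norm_num)

lemma isometric_self (h : IsIsometricAt G g F x) (u v : E) :
    G (F x) (fderiv ℝ F x u) (fderiv ℝ F x v) = g x u v := h.isometric.self_of_nhds u v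

lemma pullbackMetric_eq (h : IsIsometricAt G g F x) : pullbackMetric G F x = g x := by
  ext u v
  simp [pullbackMetric, h.isometric_self]

/-- The tangential part of the connection along `F` is the Levi-Civita connection. -/
lemma inner_covDerivAlong_fderiv (h : IsIsometricAt G g F x) (u v w : E) :
    G (F x) (covDerivAlong G F u (fun y => fderiv ℝ F y v) x) (fderiv ℝ F x w)
      = g x (christoffel g x u v) w := by
  -- Differentiate the isometry condition. Put into the Koszul formula for `g`, the six resulting
  -- terms cancel by torsion-freeness, except for two equal copies of the wanted one.
  have hd (a b c : E) : fderiv ℝ g x a b c =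
      G (F x) (covDerivAlong G F a (fun y => fderiv ℝ F y b) x) (fderiv ℝ F x c)
      + G (F x) (covDerivAlong G F a (fun y => fderiv ℝ F y c) x) (fderiv ℝ F x b) := by
    rw [h.target.symm _ (covDerivAlong G F a (fun y => fderiv ℝ F y c) x),
      ← fderiv_metric h.target h.differentiableAt (h.differentiableAt_fderiv_apply b)
      (h.differentiableAt_fderiv_apply c), Filter.EventuallyEq.fderiv_eq
      (h.isometric.mono fun y hy => hy b c), ((h.source.differentiableAt.hasFDerivAt.clm_apply
      (hasFDerivAt_const b x)).clm_apply (hasFDerivAt_const c x)).fderiv]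
    simp
  have ht (a b : E) := covDerivAlong_fderiv_comm h.target h.contDiffAt_two a b
  have hk := h.source.two_mul_inner_christoffel u v w
  rw [hd, hd, hd, ht v u, ht w u, ht w v] at hk
  linarith

/-- The tangential part of the Hessian of `F`. -/
lemma inner_hessianAlong (h : IsIsometricAt G g F x) (u v w : E) :
    G (F x) (hessianAlong G F x u v) (fderiv ℝ F x w) = g x (christoffel g x u v) w := by
  rw [hessianAlong_eq _ _ _ _ _ h.differentiableAt_fderiv, h.inner_covDerivAlong_fderiv]

/-- Differentiate G(D_v DF w, DF z) = g(∇_v w, z) along u, using metric compatibility on both sides.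
Skew-symmetrising in u and v then gives the Gauss equation. -/
lemma inner_covDerivAlong_covDerivAlong (h : IsIsometricAt G g F x) (u v w z : E) :
    G (F x) (covDerivAlong G F u (covDerivAlong G F v fun y => fderiv ℝ F y w) x) (fderiv ℝ F x z)
      = g x (covDerivAlong g id u (covDerivAlong g id v fun _ => w) x) z
        - (G (F x) (hessianAlong G F x v w) (hessianAlong G F x u z)
          - g x (christoffel g x v w) (christoffel g x u z)) := by
  have hc : DifferentiableAt ℝ (covDerivAlong g id v fun _ => w) x :=
    (contDiffAt_covDerivAlong (F := id) h.source contDiffAt_id contDiffAt_const v).differentiableAt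
      (by norm_num)
  have h1 := fderiv_metric (F := id) (x := x) h.source differentiableAt_id hc
    (differentiableAt_const z) u
  have hc' : DifferentiableAt ℝ (covDerivAlong G F v fun y => fderiv ℝ F y w) x :=
    (contDiffAt_covDerivAlong h.target h.contDiffAt_two
      (h.contDiffAt_fderiv_apply w) v).differentiableAt (by norm_num)
  have h2 := fderiv_metric h.target h.differentiableAt hc' (h.differentiableAt_fderiv_apply z) u
  have hev : (fun y => G (F y) (covDerivAlong G F v (fun y => fderiv ℝ F y w) y) (fderiv ℝ F y z))
      =ᶠ[𝓝 x] fun y => g (id y) (covDerivAlong g id v (fun _ => w) y) z := by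
    filter_upwards [h.eventually] with y hy
    rw [hy.inner_covDerivAlong_fderiv]
    simp [covDerivAlong]
  rw [hev.fderiv_eq, h1] at h2
  rw [hessianAlong_eq _ _ _ _ _ h.differentiableAt_fderiv,
    hessianAlong_eq _ _ _ _ _ h.differentiableAt_fderiv]
  have e (a b : E) : covDerivAlong g id a (fun _ => b) x = christoffel g x a b := by
    simp [covDerivAlong]
  rw [e v w, e u z] at h2
  simp only [id] at h2
  linarith

/-- The Gauss equation. -/
lemma gauss (h : IsIsometricAt G g F x) (u v w z : E) :
    G (F x) (curvature G (F x) (fderiv ℝ F x u) (fderiv ℝ F x v) (fderiv ℝ F x w)) (fderiv ℝ F x z)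
      = g x (curvature g x u v w) z
        - G (F x) (hessianAlong G F x v w - fderiv ℝ F x (christoffel g x v w))
            (hessianAlong G F x u z - fderiv ℝ F x (christoffel g x u z))
        + G (F x) (hessianAlong G F x u w - fderiv ℝ F x (christoffel g x u w))
            (hessianAlong G F x v z - fderiv ℝ F x (christoffel g x v z)) := by
  rw [← covDerivAlong_commutator h.target h.contDiffAt_two (h.contDiffAt_fderiv_apply w)]
  -- DF Γ is the tangential part of the Hessian, so the differences are normal parts, and Pythagoras
  -- splits their inner products.
  have hn (a b c d : E) :
      G (F x) (hessianAlong G F x a b - fderiv ℝ F x (christoffel g x a b))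
            (hessianAlong G F x c d - fderiv ℝ F x (christoffel g x c d))
        = G (F x) (hessianAlong G F x a b) (hessianAlong G F x c d)
          - g x (christoffel g x a b) (christoffel g x c d) := by
    have h1 := h.inner_hessianAlong a b (christoffel g x c d)
    have h2 := h.inner_hessianAlong c d (christoffel g x a b)
    have h3 := h.isometric_self (christoffel g x a b) (christoffel g x c d)
    have h4 := h.target.symm (F x) (hessianAlong G F x c d) (fderiv ℝ F x (christoffel g x a b))
    have h5 := h.source.symm x (christoffel g x c d) (christoffel g x a b)
    simp only [map_sub, sub_apply]
    linarith
  have h1 := h.inner_covDerivAlong_covDerivAlong u v w z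
  have h2 := h.inner_covDerivAlong_covDerivAlong v u w z
  rw [hn, hn, curvature]
  simp only [map_sub, sub_apply]
  linarith

lemma inner_normalPart_fderiv (h : IsIsometricAt G g F x) (w : E') (z : E) :
    G (F x) (normalPart G F x w) (fderiv ℝ F x z) = 0 := by
  rw [normalPart, h.pullbackMetric_eq, map_sub, sub_apply, h.isometric_self,
    h.source.isInvertible.self_apply_inverse]
  simp

lemma inner_normalPart (ν : E') (hν : ∀ w, G (F x) (fderiv ℝ F x w) ν = 0) (w : E') :
    G (F x) (normalPart G F x w) ν = G (F x) w ν := by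
  simp [normalPart, hν]

lemma covDerivAlong_fderiv_apply (h : IsIsometricAt G g F x) {X : E → E}
    (hX : DifferentiableAt ℝ X x) (u : E) :
    covDerivAlong G F u (fun y => fderiv ℝ F y (X y)) x
      = fderiv ℝ F x (fderiv ℝ X x u) + hessianAlong G F x u (X x) := by
  rw [covDerivAlong_apply, (h.differentiableAt_fderiv.hasFDerivAt.clm_apply hX.hasFDerivAt).fderiv]
  simp [hessianAlong, add_assoc]

variable {V : E → E'}

/-- The Ricci equation. The tangential part of `D_u V` is `DF (X u)`, where `X` is minus the shape
operator. -/
lemma ricci (h : IsIsometricAt G g F x) (hV : ContDiffAt ℝ 2 V x)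
    (hVn : ∀ᶠ y in 𝓝 x, ∀ w, G (F y) (V y) (fderiv ℝ F y w) = 0) :
    ∃ X : E → E, (∀ v w, g x (X v) w = -G (F x) (V x) (hessianAlong G F x v w)) ∧
      ∀ (u v : E) (ν : E'), (∀ w, G (F x) (fderiv ℝ F x w) ν = 0) →
        G (F x) (normalCurvature G F x u v V) ν =
          G (F x) (curvature G (F x) (fderiv ℝ F x u) (fderiv ℝ F x v) (V x)) ν
          - G (F x) (hessianAlong G F x u (X v)) ν + G (F x) (hessianAlong G F x v (X u)) ν := by
  let X (v y : E) : E := (g y).inverse ((G (F y) (covDerivAlong G F v V y)).comp (fderiv ℝ F y))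
  have hDV (v : E) : ContDiffAt ℝ 1 (covDerivAlong G F v V) x :=
    contDiffAt_covDerivAlong h.target h.contDiffAt_two hV v
  have hX (v : E) : DifferentiableAt ℝ (X v) x := by
    have h1 : ContDiffAt ℝ 1 (fun y => (g y).inverse) x :=
      (h.source.isInvertible.contDiffAt_map_inverse).comp x
        (h.source.contDiffAt.of_le (by norm_num))
    have h2 : ContDiffAt ℝ 1 (fun y => G (F y)) x :=
      (h.target.contDiffAt.of_le (by norm_num)).comp x (h.contDiffAt.of_le (by norm_num))
    exact (h1.clm_apply ((h2.clm_apply (hDV v)).clm_comp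
      (h.contDiffAt_fderiv.of_le (by norm_num)))).differentiableAt (by norm_num)
  have hdX (v : E) : DifferentiableAt ℝ (fun y => fderiv ℝ F y (X v y)) x :=
    h.differentiableAt_fderiv.clm_apply (hX v)
  have hnd (v : E) : normalDeriv G F v V =ᶠ[𝓝 x]
      fun y => covDerivAlong G F v V y - fderiv ℝ F y (X v y) := by
    filter_upwards [h.eventually] with y hy
    rw [normalDeriv, normalPart, hy.pullbackMetric_eq]
  refine ⟨fun v => X v x, fun v w => ?_, fun u v ν hν => ?_⟩
  -- The Weingarten relation: differentiate G(V, DF w) = 0, which holds near x.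
  · have h0 : fderiv ℝ (fun y => G (F y) (V y) (fderiv ℝ F y w)) x v = 0 := by
      rw [Filter.EventuallyEq.fderiv_eq (f := fun _ => 0) (hVn.mono fun y hy => hy w)]
      simp
    rw [fderiv_metric h.target h.differentiableAt (hV.differentiableAt (by norm_num))
      (h.differentiableAt_fderiv_apply w)] at h0
    rw [h.source.isInvertible.self_apply_inverse,
      hessianAlong_eq _ _ _ _ _ h.differentiableAt_fderiv]
    simp only [ContinuousLinearMap.comp_apply]
    linarith
  -- Near x, the normal derivative is D_v V − DF(X v). Differentiating DF(X v) gives a tangent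
  -- vector, invisible to ν, plus a Hessian term.
  · have key (u v : E) : G (F x) (normalDeriv G F u (normalDeriv G F v V) x) ν
        = G (F x) (covDerivAlong G F u (covDerivAlong G F v V) x) ν
          - G (F x) (hessianAlong G F x u (X v x)) ν := by
      rw [normalDeriv, inner_normalPart ν hν, covDerivAlong_congr (hnd v),
        covDerivAlong_sub ((hDV v).differentiableAt (by norm_num)) (hdX v),
        h.covDerivAlong_fderiv_apply (hX v)]
      simp [hν]
    rw [normalCurvature, ← covDerivAlong_commutator h.target h.contDiffAt_two hV]
    simp only [map_sub, sub_apply, key]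
    ring

/-- The normal connection is flat if the ambient space has constant curvature and all shape
operators are multiples of `1 + d ⊗ d` for a vector `d`. -/
lemma normalCurvature_eq_zero (h : IsIsometricAt G g F x) {c : ℝ}
    (hpos : ∀ u, u ≠ 0 → 0 < G (F x) u u)
    (hc : ∀ u v, G (F x) u u = 1 → G (F x) v v = 1 → G (F x) u v = 0 →
      G (F x) (curvature G (F x) u v v) u = c)
    (d : E) (a : E')
    (hσ : ∀ (ν : E') (u w : E), (∀ w, G (F x) (fderiv ℝ F x w) ν = 0) →
      G (F x) (hessianAlong G F x u w) ν = (g x u w + g x u d * g x w d) * G (F x) a ν)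
    (hV : ContDiffAt ℝ 2 V x)
    (hVn : ∀ᶠ y in 𝓝 x, ∀ w, G (F y) (V y) (fderiv ℝ F y w) = 0) (u v : E) :
    normalCurvature G F x u v V = 0 := by
  obtain ⟨X, hX, hR⟩ := h.ricci hV hVn
  have hs := h.target.symm (F x)
  have hs' := h.source.symm x
  have hVx (w : E) : G (F x) (fderiv ℝ F x w) (V x) = 0 := by
    rw [hs]; exact hVn.self_of_nhds w
  have hX' (v : E) : X v = (-G (F x) a (V x)) • (v + g x v d • d) := by
    refine h.source.eq_of_forall fun w => ?_
    rw [hX, hs, hσ _ _ _ hVx, hs' w d]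
    simp only [map_smul, map_add, smul_apply, add_apply, smul_eq_mul]
    ring
  -- The ambient term vanishes because `V x` is normal and the ambient curvature is constant. The
  -- two Hessian terms cancel because multiples of 1 + d ⊗ d commute.
  have hzero (ν : E') (hν : ∀ w, G (F x) (fderiv ℝ F x w) ν = 0) :
      G (F x) (normalCurvature G F x u v V) ν = 0 := by
    rw [hR u v ν hν, curvature_of_constant h.target hpos hc, hσ _ _ _ hν, hσ _ _ _ hν, hX', hX',
      hVx, hVx]
    simp only [map_smul, map_add, smul_apply, add_apply, smul_eq_mul]
    rw [hs' v u]
    ring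
  -- The normal curvature is itself normal, so it may serve as ν in `hzero`; positivity then forces
  -- it to be 0.
  have hn (w : E) : G (F x) (fderiv ℝ F x w) (normalCurvature G F x u v V) = 0 := by
    rw [hs, normalCurvature, map_sub, sub_apply]
    simp only [normalDeriv, h.inner_normalPart_fderiv, sub_zero]
  by_contra hne
  exact (hpos _ hne).ne' (hzero _ hn)

end IsIsometricAt

end Coordinates

/-! ### The metric in the preferred charts -/

section Charts

variable {n : ℕ} {M : Type*} [TopologicalSpace M] [ChartedSpace (EuclideanSpace ℝ (Fin n)) M]
  [Bundle.RiemannianBundle (fun x : M => TangentSpace (𝓡 n) x)]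

lemma chartMetric_apply (x : M) (y u v : EuclideanSpace ℝ (Fin n)) :
    chartMetric n x y u v =
      ⟪mfderiv 𝓘(ℝ, EuclideanSpace ℝ (Fin n)) (𝓡 n) (extChartAt (𝓡 n) x).symm y u,
        mfderiv 𝓘(ℝ, EuclideanSpace ℝ (Fin n)) (𝓡 n) (extChartAt (𝓡 n) x).symm y v⟫_ℝ := rfl

lemma chartMetric_symm (x : M) (y u v : EuclideanSpace ℝ (Fin n)) :
    chartMetric n x y u v = chartMetric n x y v u := by
  rw [chartMetric_apply, chartMetric_apply, real_inner_comm]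

/-- Tangent spaces at different points are the same type with different inner products. This changes
the base point without moving the vectors. -/
lemma inner_tangent_congr {p q : M} (h : p = q) (u v : EuclideanSpace ℝ (Fin n)) :
    inner ℝ (E := TangentSpace (𝓡 n) p) u v = inner ℝ (E := TangentSpace (𝓡 n) q) u v := by
  subst h; rfl

variable [IsManifold (𝓡 n) ∞ M]

lemma mdifferentiableAt_extChartAt_symm_of_mem {x : M} {y : EuclideanSpace ℝ (Fin n)}
    (hy : y ∈ (extChartAt (𝓡 n) x).target) :
    MDifferentiableAt 𝓘(ℝ, EuclideanSpace ℝ (Fin n)) (𝓡 n) (extChartAt (𝓡 n) x).symm y := by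
  have : IsManifold (𝓡 n) 1 M := IsManifold.of_le (n := ∞) (by simp)
  have := mdifferentiableWithinAt_extChartAt_symm hy
  rwa [(𝓡 n).range_eq_univ, mdifferentiableWithinAt_univ] at this

/-- The inverse chart has identity derivative at its base point. This is the bridge between
coordinate formulas and the intrinsic inner product. -/
lemma chartMetric_self (x : M) (u v : TangentSpace (𝓡 n) x) :
    chartMetric n x (extChartAt (𝓡 n) x x) u v = ⟪u, v⟫_ℝ := by
  have : IsManifold (𝓡 n) 1 M := IsManifold.of_le (n := ∞) (by simp)
  have h := mfderivWithin_range_extChartAt_symm (I := 𝓡 n) (x := x)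
  rw [(𝓡 n).range_eq_univ, mfderivWithin_univ] at h
  have h' (u : EuclideanSpace ℝ (Fin n)) :
      mfderiv 𝓘(ℝ, EuclideanSpace ℝ (Fin n)) (𝓡 n) (extChartAt (𝓡 n) x).symm
        (extChartAt (𝓡 n) x x) u = u := congrArg (fun L => L u) h
  refine (inner_tangent_congr (extChartAt_to_inv (I := 𝓡 n) x) _ _).trans ?_
  exact congrArg₂ (fun a b => inner ℝ (E := TangentSpace (𝓡 n) x) a b) (h' u) (h' v)

lemma chartMetric_self_pos (x : M) (u : EuclideanSpace ℝ (Fin n)) (hu : u ≠ 0) :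
    0 < chartMetric n x (extChartAt (𝓡 n) x x) u u := by
  have := chartMetric_self x u u
  rw [this]
  exact real_inner_self_pos.2 hu

variable [IsContMDiffRiemannianBundle (𝓡 n) ∞ (EuclideanSpace ℝ (Fin n))
      (fun x : M => TangentSpace (𝓡 n) x)]

/-- The entries are inner products of pushed-forward constant fields, which are smooth because the
tangent map of the inverse chart is. -/
lemma contDiffOn_chartMetric (x : M) :
    ContDiffOn ℝ ∞ (chartMetric n x) (extChartAt (𝓡 n) x).target := by
  have hs : ContMDiffOn 𝓘(ℝ, EuclideanSpace ℝ (Fin n)) (𝓡 n) ∞ (extChartAt (𝓡 n) x).symm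
      (extChartAt (𝓡 n) x).target := contMDiffOn_extChartAt_symm x
  have ho : IsOpen (extChartAt (𝓡 n) x).target := isOpen_extChartAt_target x
  have hsec (u : EuclideanSpace ℝ (Fin n)) : ContMDiffOn 𝓘(ℝ, EuclideanSpace ℝ (Fin n))
      (𝓡 n).tangent ∞ (fun y => (⟨(extChartAt (𝓡 n) x).symm y,
        mfderiv 𝓘(ℝ, EuclideanSpace ℝ (Fin n)) (𝓡 n) (extChartAt (𝓡 n) x).symm y u⟩ :
          TangentBundle (𝓡 n) M)) (extChartAt (𝓡 n) x).target := by
    have h1 := hs.contMDiffOn_tangentMapWithin (m := ∞) (by simp) ho.uniqueMDiffOn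
    have h2 : ContMDiff 𝓘(ℝ, EuclideanSpace ℝ (Fin n)) 𝓘(ℝ, EuclideanSpace ℝ (Fin n)).tangent ∞
        (fun y => (⟨y, u⟩ : TangentBundle 𝓘(ℝ, EuclideanSpace ℝ (Fin n))
          (EuclideanSpace ℝ (Fin n)))) :=
      contMDiff_vectorSpace_iff_contDiff.2 contDiff_const
    refine (h1.comp h2.contMDiffOn (fun y hy => hy)).congr fun y hy => ?_
    simp only [Function.comp, tangentMapWithin]
    rw [mfderivWithin_of_isOpen ho hy]
  refine contDiffOn_clm_apply.2 fun u => contDiffOn_clm_apply.2 fun v => ?_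
  rw [← contMDiffOn_iff_contDiffOn]
  exact ContMDiffOn.inner_bundle (E := fun x : M => TangentSpace (𝓡 n) x)
    (F := EuclideanSpace ℝ (Fin n)) (hsec u) (hsec v)

lemma isMetricAt_chartMetric (x : M) :
    IsMetricAt (chartMetric n x) (extChartAt (𝓡 n) x x) where
  contDiffAt := ((contDiffOn_chartMetric x).contDiffAt (extChartAt_target_mem_nhds x)).of_le
    ENat.LEInfty.out
  symm := chartMetric_symm x
  isInvertible := isInvertible_of_nondegenerate fun u hu => by
    by_contra hne
    exact (chartMetric_self_pos x u hne).ne' (by rw [hu]; rfl)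

end Charts

/-! ### Isometric immersions written in charts. -/

section Immersion

variable {n m : ℕ}
  {M : Type*} [TopologicalSpace M] [ChartedSpace (EuclideanSpace ℝ (Fin n)) M]
  [Bundle.RiemannianBundle (fun x : M => TangentSpace (𝓡 n) x)]
  {N : Type*} [TopologicalSpace N] [ChartedSpace (EuclideanSpace ℝ (Fin m)) N]
  [Bundle.RiemannianBundle (fun x : N => TangentSpace (𝓡 m) x)]
  {f : M → N}

lemma localRep_self (f : M → N) (p : M) :
    localRep n m f p (extChartAt (𝓡 n) p p) = extChartAt (𝓡 m) (f p) (f p) := by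
  simp [localRep, writtenInExtChartAt]

lemma fderiv_localRep (hf : MDifferentiableAt (𝓡 n) (𝓡 m) f p) :
    fderiv ℝ (localRep n m f p) (extChartAt (𝓡 n) p p) = mfderiv (𝓡 n) (𝓡 m) f p := by
  rw [hf.mfderiv, (𝓡 n).range_eq_univ, fderivWithin_univ]; rfl

variable [IsManifold (𝓡 n) ∞ M] [IsManifold (𝓡 m) ∞ N]

lemma chartMetric_localRep (hf : IsIsometricImmersion n m f) (p : M) {y : EuclideanSpace ℝ (Fin n)}
    (hy : y ∈ (extChartAt (𝓡 n) p).target)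
    (hy' : f ((extChartAt (𝓡 n) p).symm y) ∈ (extChartAt (𝓡 m) (f p)).source)
    (u v : EuclideanSpace ℝ (Fin n)) :
    chartMetric m (f p) (localRep n m f p y) (fderiv ℝ (localRep n m f p) y u)
      (fderiv ℝ (localRep n m f p) y v) = chartMetric n p y u v := by
  have hψ := mdifferentiableAt_extChartAt_symm_of_mem (M := M) hy
  have hFy : localRep n m f p y ∈ (extChartAt (𝓡 m) (f p)).target :=
    (extChartAt (𝓡 m) (f p)).map_source hy'
  have hΦ := mdifferentiableAt_extChartAt_symm_of_mem (M := N) hFy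
  have hfd : MDifferentiableAt (𝓡 n) (𝓡 m) f ((extChartAt (𝓡 n) p).symm y) :=
    (hf.smooth _).mdifferentiableAt (by simp)
  have hfψ := hfd.comp y hψ
  have hchart : MDifferentiableAt (𝓡 m) 𝓘(ℝ, EuclideanSpace ℝ (Fin m)) (extChartAt (𝓡 m) (f p))
      (f ((extChartAt (𝓡 n) p).symm y)) := by
    have : IsManifold (𝓡 m) 1 N := IsManifold.of_le (n := ∞) (by simp)
    exact mdifferentiableAt_extChartAt (by simpa using hy')
  have hF : MDifferentiableAt 𝓘(ℝ, EuclideanSpace ℝ (Fin n)) 𝓘(ℝ, EuclideanSpace ℝ (Fin m))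
      (localRep n m f p) y :=
    MDifferentiableAt.comp (f := f ∘ (extChartAt (𝓡 n) p).symm) y hchart hfψ
  -- Undoing the target chart recovers f after the inverse source chart; the chain rule on both
  -- sides reduces the claim to the isometry of f.
  have hev : (extChartAt (𝓡 m) (f p)).symm ∘ localRep n m f p
      =ᶠ[𝓝 y] f ∘ (extChartAt (𝓡 n) p).symm := by
    filter_upwards [hfψ.continuousAt.eventually
      ((isOpen_extChartAt_source (I := 𝓡 m) (f p)).mem_nhds hy')] with z hz
    exact (extChartAt (𝓡 m) (f p)).left_inv hz
  have key (u : EuclideanSpace ℝ (Fin n)) :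
      (mfderiv 𝓘(ℝ, EuclideanSpace ℝ (Fin m)) (𝓡 m) (extChartAt (𝓡 m) (f p)).symm
        (localRep n m f p y) (fderiv ℝ (localRep n m f p) y u) : EuclideanSpace ℝ (Fin m))
      = mfderiv (𝓡 n) (𝓡 m) f ((extChartAt (𝓡 n) p).symm y)
        (mfderiv 𝓘(ℝ, EuclideanSpace ℝ (Fin n)) (𝓡 n) (extChartAt (𝓡 n) p).symm y u) := by
    have h1 := mfderiv_comp_apply y hΦ hF u
    have h2 := mfderiv_comp_apply y hfd hψ u
    rw [mfderiv_eq_fderiv] at h1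
    exact h1.symm.trans ((congrArg (fun L : EuclideanSpace ℝ (Fin n) →L[ℝ]
      EuclideanSpace ℝ (Fin m) => L u) hev.mfderiv_eq).trans h2)
  refine (inner_tangent_congr hev.self_of_nhds _ _).trans ?_
  refine (congrArg₂ (fun a b => inner ℝ
    (E := TangentSpace (𝓡 m) (f ((extChartAt (𝓡 n) p).symm y))) a b) (key u) (key v)).trans ?_
  exact hf.isometric _ _ _

variable [IsContMDiffRiemannianBundle (𝓡 n) ∞ (EuclideanSpace ℝ (Fin n))
      (fun x : M => TangentSpace (𝓡 n) x)]
  [IsContMDiffRiemannianBundle (𝓡 m) ∞ (EuclideanSpace ℝ (Fin m))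
      (fun x : N => TangentSpace (𝓡 m) x)]

lemma isIsometricAt_localRep (hf : IsIsometricImmersion n m f) (p : M) :
    IsIsometricAt (chartMetric m (f p)) (chartMetric n p) (localRep n m f p)
      (extChartAt (𝓡 n) p p) where
  target := by rw [localRep_self]; exact isMetricAt_chartMetric (f p)
  source := isMetricAt_chartMetric p
  contDiffAt := by
    have := (contMDiffAt_iff.1 (hf.smooth p)).2
    rw [(𝓡 n).range_eq_univ, contDiffWithinAt_univ] at this
    exact this.of_le ENat.LEInfty.out
  isometric := by
    have hc : ContinuousAt (fun y => f ((extChartAt (𝓡 n) p).symm y)) (extChartAt (𝓡 n) p p) :=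
      ContinuousAt.comp (by simpa using hf.smooth.continuous.continuousAt)
        (continuousAt_extChartAt_symm p)
    filter_upwards [extChartAt_target_mem_nhds (I := 𝓡 n) p,
      hc.preimage_mem_nhds (t := (extChartAt (𝓡 m) (f p)).source)
        (by rw [extChartAt_to_inv]; exact extChartAt_source_mem_nhds (I := 𝓡 m) (f p))]
      with y hy hy' u v using chartMetric_localRep hf p hy hy' u v

end Immersion

/-! ### The algebraic inequality -/

section Algebra

variable {V W : Type*} [NormedAddCommGroup V] [InnerProductSpace ℝ V] [FiniteDimensional ℝ V]
  [NormedAddCommGroup W] [InnerProductSpace ℝ W] [FiniteDimensional ℝ W]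
  {ι ι' : Type*} [Fintype ι] [Fintype ι']

/-- Both sums are the trace of L*L. -/
lemma sum_norm_sq_apply_eq (L : V →ₗ[ℝ] W) (b : OrthonormalBasis ι ℝ V)
    (b' : OrthonormalBasis ι' ℝ V) : ∑ i, ‖L (b i)‖ ^ 2 = ∑ i, ‖L (b' i)‖ ^ 2 := by
  have h (v : V) : ‖L v‖ ^ 2 = ⟪v, (LinearMap.adjoint L ∘ₗ L) v⟫_ℝ := by
    rw [LinearMap.comp_apply, LinearMap.adjoint_inner_right, real_inner_self_eq_norm_sq]
  simp_rw [h]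
  rw [← LinearMap.trace_eq_sum_inner, ← LinearMap.trace_eq_sum_inner]

lemma sum_sum_norm_sq_apply_eq (σ : V →ₗ[ℝ] V →ₗ[ℝ] W) (b : OrthonormalBasis ι ℝ V)
    (b' : OrthonormalBasis ι' ℝ V) :
    ∑ i, ∑ j, ‖σ (b i) (b j)‖ ^ 2 = ∑ i, ∑ j, ‖σ (b' i) (b' j)‖ ^ 2 := by
  calc ∑ i, ∑ j, ‖σ (b i) (b j)‖ ^ 2 = ∑ i, ∑ j, ‖σ (b i) (b' j)‖ ^ 2 :=
        Finset.sum_congr rfl fun i _ => sum_norm_sq_apply_eq (σ (b i)) b b'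
    _ = ∑ j, ∑ i, ‖σ.flip (b' j) (b i)‖ ^ 2 := Finset.sum_comm
    _ = ∑ j, ∑ i, ‖σ.flip (b' j) (b' i)‖ ^ 2 :=
        Finset.sum_congr rfl fun i _ => sum_norm_sq_apply_eq _ b b'
    _ = ∑ i, ∑ j, ‖σ (b' i) (b' j)‖ ^ 2 := Finset.sum_comm

lemma sum_apply_self_eq (σ : V →ₗ[ℝ] V →ₗ[ℝ] W) (b : OrthonormalBasis ι ℝ V)
    (b' : OrthonormalBasis ι' ℝ V) : ∑ i, σ (b i) (b i) = ∑ i, σ (b' i) (b' i) := by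
  refine ext_inner_right ℝ fun w => ?_
  let A : V →ₗ[ℝ] V :=
    { toFun := fun v => LinearMap.adjoint (σ v) w
      map_add' := fun u v => by simp
      map_smul' := fun a v => by simp }
  have h (v : V) : ⟪σ v v, w⟫_ℝ = ⟪v, A v⟫_ℝ := by
    simp [A, LinearMap.adjoint_inner_right]
  simp_rw [sum_inner, h]
  rw [← LinearMap.trace_eq_sum_inner, ← LinearMap.trace_eq_sum_inner]

/-- Bases adapted to a hyperplane: `none` indexes the unit normal. -/
lemma exists_orthonormalBasis_option {P : Submodule ℝ V}
    (hP : Module.finrank ℝ P + 1 = Module.finrank ℝ V) {d : V} (hd : ‖d‖ = 1) (hdP : d ∈ Pᗮ)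
    (e : OrthonormalBasis ι ℝ P) :
    ∃ b : OrthonormalBasis (Option ι) ℝ V, b none = d ∧ ∀ i, b (some i) = e i := by
  classical
  have ho : Orthonormal ℝ (fun i : Option ι => i.elim d fun j => (e j : V)) := by
    rw [orthonormal_iff_ite]
    have h0 (i : ι) : ⟪(e i : V), d⟫_ℝ = 0 := hdP _ (e i).2
    rintro (_ | i) (_ | j)
    · simp [hd]
    · simpa [real_inner_comm] using h0 j
    · simp [h0]
    · have := orthonormal_iff_ite.1 e.orthonormal i j
      simpa using this
  have hcard : Fintype.card (Option ι) = Module.finrank ℝ V := by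
    rw [Fintype.card_option, ← hP, Module.finrank_eq_card_basis e.toBasis]
  refine ⟨(basisOfOrthonormalOfCardEqFinrank ho hcard).toOrthonormalBasis (by simpa using ho),
    by simp, by simp⟩

lemma exists_unit_normal {P : Submodule ℝ V}
    (hP : Module.finrank ℝ P + 1 = Module.finrank ℝ V) : ∃ d ∈ Pᗮ, ‖d‖ = 1 := by
  have h := Submodule.finrank_add_finrank_orthogonal P
  have : Nontrivial Pᗮ := Module.finrank_pos_iff (R := ℝ).1 (by omega)
  obtain ⟨v, hv⟩ := exists_norm_eq Pᗮ zero_le_one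
  exact ⟨v, v.2, hv⟩

lemma finrank_orthogonal_span {d : V} (hd : ‖d‖ = 1) :
    Module.finrank ℝ (ℝ ∙ d)ᗮ + 1 = Module.finrank ℝ V := by
  have h := Submodule.finrank_add_finrank_orthogonal (ℝ ∙ d)
  rw [finrank_span_singleton (by rintro rfl; simp at hd)] at h
  omega

/-- The algebraic identity behind the inequality. -/
lemma casorati_identity (σ : V →ₗ[ℝ] V →ₗ[ℝ] W) (hσ : ∀ u v, σ u v = σ v u) [DecidableEq ι]
    (b : Option ι → V) {n : ℝ} (hn : (Fintype.card ι : ℝ) + 1 = n) (a : W)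
    (ha : ∑ i, σ (b i) (b i) = (n + 1) • a) :
    (n + 1) * ∑ i, ∑ j, ‖σ (b i) (b j)‖ ^ 2
        + (n + 1) * ∑ i, ∑ j, ‖σ (b (some i)) (b (some j))‖ ^ 2
        - 2 * ‖∑ i, σ (b i) (b i)‖ ^ 2
      = (n + 1) * (2 * ∑ i, ∑ j, ‖σ (b (some i)) (b (some j)) - if i = j then a else 0‖ ^ 2
          + 2 * ∑ i, ‖σ (b (some i)) (b none)‖ ^ 2 + ‖σ (b none) (b none) - (2 : ℝ) • a‖ ^ 2) := by
  have h1 : ∑ i, ∑ j, ‖σ (b i) (b j)‖ ^ 2 = ∑ i, ∑ j, ‖σ (b (some i)) (b (some j))‖ ^ 2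
      + 2 * ∑ i, ‖σ (b (some i)) (b none)‖ ^ 2 + ‖σ (b none) (b none)‖ ^ 2 := by
    simp only [Fintype.sum_option, Finset.sum_add_distrib, hσ (b none) (b (some _))]
    ring
  have h2 : ∑ i, ∑ j, ‖σ (b (some i)) (b (some j)) - if i = j then a else 0‖ ^ 2
      = ∑ i, ∑ j, ‖σ (b (some i)) (b (some j))‖ ^ 2
        - 2 * ⟪∑ i, σ (b (some i)) (b (some i)), a⟫_ℝ + (n - 1) * ‖a‖ ^ 2 := by
    have (i j : ι) : ‖σ (b (some i)) (b (some j)) - if i = j then a else 0‖ ^ 2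
        = ‖σ (b (some i)) (b (some j))‖ ^ 2 + if i = j then
          -2 * ⟪σ (b (some i)) (b (some j)), a⟫_ℝ + ‖a‖ ^ 2 else 0 := by
      split_ifs
      · rw [norm_sub_sq_real]; ring
      · simp
    simp only [this, Finset.sum_add_distrib, Finset.sum_ite_eq, Finset.mem_univ, if_true,
      Finset.sum_const, Finset.card_univ, nsmul_eq_mul, sum_inner, ← Finset.mul_sum]
    rw [← hn]
    ring
  have h3 : ‖σ (b none) (b none) - (2 : ℝ) • a‖ ^ 2 = ‖σ (b none) (b none)‖ ^ 2
      - 4 * ⟪σ (b none) (b none), a⟫_ℝ + 4 * ‖a‖ ^ 2 := by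
    rw [norm_sub_sq_real, inner_smul_right, norm_smul]
    norm_num
    ring
  -- The choice of `a` turns the sum of the cross terms of `h2` and `h3` into a multiple of ‖a‖².
  have h4 : ⟪σ (b none) (b none), a⟫_ℝ + ⟪∑ i, σ (b (some i)) (b (some i)), a⟫_ℝ
      = (n + 1) * ‖a‖ ^ 2 := by
    rw [← inner_add_left, ← Fintype.sum_option (f := fun i => σ (b i) (b i)), ha, inner_smul_left,
      real_inner_self_eq_norm_sq]
    simp
  have h5 : ‖(n + 1) • a‖ ^ 2 = (n + 1) ^ 2 * ‖a‖ ^ 2 := by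
    rw [norm_smul, mul_pow, Real.norm_eq_abs, sq_abs]
  rw [h1, h2, h3, ha, h5]
  linear_combination 4 * (n + 1) * h4

/-- The Casorati curvature of a subspace with respect to a bilinear map. -/
noncomputable def casoratiOf (σ : V →ₗ[ℝ] V →ₗ[ℝ] W) (P : Submodule ℝ V) : ℝ :=
  1 / (Module.finrank ℝ P : ℝ) * ∑ i, ∑ j,
    ‖σ (stdOrthonormalBasis ℝ P i) (stdOrthonormalBasis ℝ P j)‖ ^ 2

lemma casoratiOf_top (σ : V →ₗ[ℝ] V →ₗ[ℝ] W) (b : OrthonormalBasis ι ℝ V) :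
    casoratiOf σ ⊤ = 1 / (Module.finrank ℝ V : ℝ) * ∑ i, ∑ j, ‖σ (b i) (b j)‖ ^ 2 := by
  have hf : Module.finrank ℝ (⊤ : Submodule ℝ V) = Module.finrank ℝ V := finrank_top ℝ V
  rw [casoratiOf, ← hf]
  congr 1
  let τ : (⊤ : Submodule ℝ V) →ₗ[ℝ] (⊤ : Submodule ℝ V) →ₗ[ℝ] W :=
    σ.compl₁₂ (Submodule.subtype _) (Submodule.subtype _)
  have := sum_sum_norm_sq_apply_eq τ (stdOrthonormalBasis ℝ (⊤ : Submodule ℝ V))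
    (b.map (LinearIsometryEquiv.ofTop V (⊤ : Submodule ℝ V) rfl).symm)
  simpa [τ] using this

/-- The form of `σ` in the case of equality: with respect to an orthonormal basis with last vector
`d`, it is `diag(a, …, a, 2a)`. -/
def IsIdealForm (σ : V →ₗ[ℝ] V →ₗ[ℝ] W) (d : V) (a : W) : Prop :=
  ∀ u v, σ u v = (⟪u, v⟫_ℝ + ⟪u, d⟫_ℝ * ⟪v, d⟫_ℝ) • a

/-- Inclusion–exclusion in an adapted basis: delete the row and column of d, and restore the corner
counted twice. The result is visibly continuous in d. -/
lemma casoratiOf_hyperplane {σ : V →ₗ[ℝ] V →ₗ[ℝ] W} (hσ : ∀ u v, σ u v = σ v u)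
    {n : ℕ} (hV : Module.finrank ℝ V = n) (b : OrthonormalBasis ι ℝ V)
    {P : Submodule ℝ V} (hP : Module.finrank ℝ P + 1 = n) {d : V} (hd : ‖d‖ = 1) (hdP : d ∈ Pᗮ) :
    casoratiOf σ P = 1 / ((n : ℝ) - 1) *
    (∑ i, ∑ j, ‖σ (b i) (b j)‖ ^ 2 - 2 * ∑ i, ‖σ (b i) d‖ ^ 2 + ‖σ d d‖ ^ 2) := by
  obtain ⟨b', h0, h1⟩ := exists_orthonormalBasis_option (hP.trans hV.symm) hd hdP
    (stdOrthonormalBasis ℝ P)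
  have hk : (Module.finrank ℝ P : ℝ) = (n : ℝ) - 1 := by rw [← hP]; simp
  have e := sum_norm_sq_apply_eq (σ.flip d) b b'
  simp only [LinearMap.flip_apply] at e
  rw [casoratiOf, hk, sum_sum_norm_sq_apply_eq σ b b', e]
  simp only [Fintype.sum_option, Finset.sum_add_distrib, h0, h1, hσ d (stdOrthonormalBasis ℝ P _)]
  ring

/-- The inequality for one hyperplane, cleared of denominators; it is the sum of squares of
`casorati_identity`. -/
lemma casorati_inequality_aux {σ : V →ₗ[ℝ] V →ₗ[ℝ] W} (hσ : ∀ u v, σ u v = σ v u)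
    {n : ℕ} (hn : 2 ≤ n) (hV : Module.finrank ℝ V = n) (b : OrthonormalBasis ι ℝ V)
    {P : Submodule ℝ V} (hP : Module.finrank ℝ P + 1 = n) {d : V} (hd : ‖d‖ = 1) (hdP : d ∈ Pᗮ) :
    0 ≤ ((n : ℝ) + 1) * ∑ i, ∑ j, ‖σ (b i) (b j)‖ ^ 2
        + ((n : ℝ) + 1) * (((n : ℝ) - 1) * casoratiOf σ P) - 2 * ‖∑ i, σ (b i) (b i)‖ ^ 2 ∧
    (((n : ℝ) + 1) * ∑ i, ∑ j, ‖σ (b i) (b j)‖ ^ 2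
        + ((n : ℝ) + 1) * (((n : ℝ) - 1) * casoratiOf σ P) - 2 * ‖∑ i, σ (b i) (b i)‖ ^ 2 = 0 ↔
      ∃ a, IsIdealForm σ d a) := by
  classical
  obtain ⟨b', h0, h1⟩ := exists_orthonormalBasis_option (hP.trans hV.symm) hd hdP
    (stdOrthonormalBasis ℝ P)
  have hk : (Module.finrank ℝ P : ℝ) = (n : ℝ) - 1 := by rw [← hP]; simp
  have hn2 : (2 : ℝ) ≤ n := by exact_mod_cast hn
  have hk0 : (n : ℝ) - 1 ≠ 0 := by linarith
  have hc : ((n : ℝ) - 1) * casoratiOf σ P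
      = ∑ i, ∑ j, ‖σ (b' (some i)) (b' (some j))‖ ^ 2 := by
    simp only [casoratiOf, hk, h1]
    field_simp
  have hn1 : (0 : ℝ) < n + 1 := by positivity
  obtain ⟨a, ha⟩ : ∃ a : W, ∑ i, σ (b' i) (b' i) = ((n : ℝ) + 1) • a :=
    ⟨((n : ℝ) + 1)⁻¹ • ∑ i, σ (b' i) (b' i), by rw [smul_inv_smul₀ hn1.ne']⟩
  have hcard : (Fintype.card (Fin (Module.finrank ℝ P)) : ℝ) + 1 = n := by simp [hk]
  have key := casorati_identity σ hσ b' hcard a ha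
  rw [sum_sum_norm_sq_apply_eq σ b b', sum_apply_self_eq σ b b', hc, key]
  refine ⟨by positivity, fun h => ⟨a, ?_⟩, ?_⟩
  · have hA : 0 ≤ ∑ i, ∑ j, ‖σ (b' (some i)) (b' (some j)) - if i = j then a else 0‖ ^ 2 := by
      positivity
    have hB : 0 ≤ ∑ i, ‖σ (b' (some i)) (b' none)‖ ^ 2 := by positivity
    have hC : 0 ≤ ‖σ (b' none) (b' none) - (2 : ℝ) • a‖ ^ 2 := by positivity
    have hsum := (mul_eq_zero.1 h).resolve_left hn1.ne'
    have hA' : ∑ i, ∑ j, ‖σ (b' (some i)) (b' (some j)) - if i = j then a else 0‖ ^ 2 = 0 := by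
      linarith
    have hB' : ∑ i, ‖σ (b' (some i)) (b' none)‖ ^ 2 = 0 := by linarith
    have hC' : ‖σ (b' none) (b' none) - (2 : ℝ) • a‖ ^ 2 = 0 := by linarith
    have eB (i) : σ (b' (some i)) (b' none) = 0 := by
      have := (Finset.sum_eq_zero_iff_of_nonneg fun _ _ => by positivity).1 hB' i (Finset.mem_univ _)
      simpa using this
    have eC : σ (b' none) (b' none) = (2 : ℝ) • a := by
      rw [← sub_eq_zero]; simpa using hC'
    have eA (i j) : σ (b' (some i)) (b' (some j)) = if i = j then a else 0 := by
      have := (Finset.sum_eq_zero_iff_of_nonneg fun _ _ => by positivity).1 hA' i (Finset.mem_univ _)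
      have := (Finset.sum_eq_zero_iff_of_nonneg fun _ _ => by positivity).1 this j
        (Finset.mem_univ _)
      rw [← sub_eq_zero]; simpa using this
    let τ : V →ₗ[ℝ] V →ₗ[ℝ] W := LinearMap.mk₂ ℝ
      (fun u v => (⟪u, v⟫_ℝ + ⟪u, d⟫_ℝ * ⟪v, d⟫_ℝ) • a)
      (fun u u' v => by rw [inner_add_left, inner_add_left, ← add_smul]; ring_nf)
      (fun r u v => by
        rw [real_inner_smul_left, real_inner_smul_left, smul_smul]; ring_nf)
      (fun u v v' => by rw [inner_add_right, inner_add_left, ← add_smul]; ring_nf)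
      (fun r u v => by
        rw [real_inner_smul_right, real_inner_smul_left, smul_smul]; ring_nf)
    have hτ : σ = τ := by
      refine b'.toBasis.ext fun i => b'.toBasis.ext fun j => ?_
      have hon := orthonormal_iff_ite.1 b'.orthonormal
      simp only [OrthonormalBasis.coe_toBasis, τ, LinearMap.mk₂_apply]
      rw [← h0, hon, hon, hon]
      rcases i with _ | i <;> rcases j with _ | j
      · simp [eC]; norm_num
      · simp [hσ (b' none), eB]
      · simp [eB]
      · simp [eA]
    intro u v
    rw [hτ]
    rfl
  · rintro ⟨a', ha'⟩
    have hon := orthonormal_iff_ite.1 b'.orthonormal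
    have hform (i j) : σ (b' i) (b' j) =
        ((if i = j then 1 else 0) + (if i = none then 1 else 0) * if j = none then 1 else 0 : ℝ)
          • a' := by
      rw [ha', ← h0, hon, hon, hon]
    -- The trace of diag(a', …, a', 2a') is (n + 1)a'.
    have haa : a = a' := by
      have : ∑ i, σ (b' i) (b' i) = ((n : ℝ) + 1) • a' := by
        simp only [hform, ← Finset.sum_smul, Fintype.sum_option]
        congr 1
        simp [hk]
        ring
      rw [ha] at this
      exact smul_right_injective W hn1.ne' this
    subst haa
    have e1 : (1 : ℝ) + 1 = 2 := by norm_num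
    simp [hform, e1]

/-- The set of Casorati curvatures of the hyperplanes has a least element. -/
lemma sInf_casoratiOf_mem {σ : V →ₗ[ℝ] V →ₗ[ℝ] W} (hσ : ∀ u v, σ u v = σ v u) {n : ℕ}
    (hn : 2 ≤ n) (hV : Module.finrank ℝ V = n) :
    ∃ P : Submodule ℝ V, Module.finrank ℝ P + 1 = n ∧
      sInf {r | ∃ P : Submodule ℝ V, Module.finrank ℝ P + 1 = n ∧ r = casoratiOf σ P}
        = casoratiOf σ P ∧
      ∀ P' : Submodule ℝ V, Module.finrank ℝ P' + 1 = n → casoratiOf σ P ≤ casoratiOf σ P' := by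
  let b := stdOrthonormalBasis ℝ V
  let q (d : V) : ℝ := 1 / ((n : ℝ) - 1) *
    (∑ i, ∑ j, ‖σ (b i) (b j)‖ ^ 2 - 2 * ∑ i, ‖σ (b i) d‖ ^ 2 + ‖σ d d‖ ^ 2)
  -- Hyperplanes correspond to unit normals, so the infimum is that of a continuous function on a
  -- compact sphere.
  have hset : {r | ∃ P : Submodule ℝ V, Module.finrank ℝ P + 1 = n ∧ r = casoratiOf σ P}
      = q '' Metric.sphere 0 1 := by
    ext r
    constructor
    · rintro ⟨P, hP, rfl⟩
      obtain ⟨d, hdP, hd⟩ := exists_unit_normal (hP.trans hV.symm)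
      exact ⟨d, by simpa using hd, (casoratiOf_hyperplane hσ hV b hP hd hdP).symm⟩
    · rintro ⟨d, hd, rfl⟩
      have hd' : ‖d‖ = 1 := by simpa using hd
      have hP := (finrank_orthogonal_span hd').trans hV
      refine ⟨(ℝ ∙ d)ᗮ, hP, (casoratiOf_hyperplane hσ hV b hP hd' ?_).symm⟩
      rw [Submodule.orthogonal_orthogonal]
      exact Submodule.mem_span_singleton_self d
  have hcont : Continuous q := by
    have h1 (u : V) : Continuous (σ u) := (σ u).continuous_of_finiteDimensional
    have h2 : Continuous fun d => σ d d :=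
      σ.toContinuousBilinearMap.continuous.clm_apply continuous_id
    have h3 : Continuous fun d => ∑ i, ‖σ (b i) d‖ ^ 2 :=
      continuous_finsetSum _ fun i _ => (h1 (b i)).norm.pow 2
    exact continuous_const.mul
      ((continuous_const.sub (continuous_const.mul h3)).add (h2.norm.pow 2))
  have : Nontrivial V := Module.finrank_pos_iff (R := ℝ).1 (by omega)
  have hcomp : IsCompact (q '' Metric.sphere (0 : V) 1) := (isCompact_sphere 0 1).image hcont
  have hne : (q '' Metric.sphere (0 : V) 1).Nonempty :=
    (NormedSpace.sphere_nonempty.2 zero_le_one).image q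
  have hmem := hcomp.sInf_mem hne
  have hbdd := hcomp.bddBelow
  rw [← hset] at hmem hbdd
  obtain ⟨P, hP, hr⟩ := hmem
  exact ⟨P, hP, hr, fun P' hP' => hr ▸ csInf_le hbdd ⟨P', hP', rfl⟩⟩

lemma casorati_inequality {σ : V →ₗ[ℝ] V →ₗ[ℝ] W} (hσ : ∀ u v, σ u v = σ v u) {n : ℕ}
    (hn : 2 ≤ n) (hV : Module.finrank ℝ V = n) (b : OrthonormalBasis ι ℝ V) :
    (‖∑ i, σ (b i) (b i)‖ ^ 2 - ∑ i, ∑ j, ‖σ (b i) (b j)‖ ^ 2) / ((n : ℝ) * (n - 1)) ≤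
      1 / 2 * casoratiOf σ ⊤ + ((n : ℝ) + 1) / (2 * n) *
        sInf {r | ∃ P : Submodule ℝ V, Module.finrank ℝ P + 1 = n ∧ r = casoratiOf σ P} ∧
    ((‖∑ i, σ (b i) (b i)‖ ^ 2 - ∑ i, ∑ j, ‖σ (b i) (b j)‖ ^ 2) / ((n : ℝ) * (n - 1)) =
      1 / 2 * casoratiOf σ ⊤ + ((n : ℝ) + 1) / (2 * n) *
        sInf {r | ∃ P : Submodule ℝ V, Module.finrank ℝ P + 1 = n ∧ r = casoratiOf σ P} ↔
      ∃ d a, ‖d‖ = 1 ∧ IsIdealForm σ d a) := by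
  obtain ⟨P, hP, hr, hmin⟩ := sInf_casoratiOf_mem hσ hn hV
  rw [hr, casoratiOf_top σ b, hV]
  obtain ⟨d, hdP, hd⟩ := exists_unit_normal (hP.trans hV.symm)
  have hn2 : (2 : ℝ) ≤ n := by exact_mod_cast hn
  obtain ⟨h1, h2⟩ := casorati_inequality_aux hσ hn hV b hP hd hdP
  have key : 1 / 2 * (1 / (n : ℝ) * ∑ i, ∑ j, ‖σ (b i) (b j)‖ ^ 2)
      + ((n : ℝ) + 1) / (2 * n) * casoratiOf σ P
      - (‖∑ i, σ (b i) (b i)‖ ^ 2 - ∑ i, ∑ j, ‖σ (b i) (b j)‖ ^ 2) / ((n : ℝ) * (n - 1))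
      = (((n : ℝ) + 1) * ∑ i, ∑ j, ‖σ (b i) (b j)‖ ^ 2
        + ((n : ℝ) + 1) * (((n : ℝ) - 1) * casoratiOf σ P) - 2 * ‖∑ i, σ (b i) (b i)‖ ^ 2)
        / (2 * n * (n - 1)) := by
    have : (n : ℝ) - 1 ≠ 0 := by linarith
    have : (n : ℝ) ≠ 0 := by linarith
    field_simp
    ring
  have hpos : (0 : ℝ) < 2 * n * (n - 1) := by
    have : (0 : ℝ) < n - 1 := by linarith
    positivity
  refine ⟨?_, fun h => ?_, ?_⟩
  · have := div_nonneg h1 hpos.le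
    linarith
  · rw [h, sub_self, eq_comm, div_eq_zero_iff] at key
    obtain ⟨a, ha⟩ := h2.1 (key.resolve_right hpos.ne')
    exact ⟨d, a, hd, ha⟩
  · rintro ⟨d', a, hd', ha⟩
    have hP' := (finrank_orthogonal_span hd').trans hV
    have h3 := (casorati_inequality_aux hσ hn hV b hP' hd' (by
      rw [Submodule.orthogonal_orthogonal]
      exact Submodule.mem_span_singleton_self d')).2.2 ⟨a, ha⟩
    have h4 := hmin _ hP'
    have h5 : ((n : ℝ) + 1) * ((n - 1) * casoratiOf σ P)
        ≤ ((n : ℝ) + 1) * ((n - 1) * casoratiOf σ (ℝ ∙ d')ᗮ) := by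
      have : (0 : ℝ) ≤ n - 1 := by linarith
      gcongr
    -- The defect at the minimiser P is nonnegative and at most the defect at the orthogonal
    -- complement of `d'`, which is 0.
    have h6 := le_antisymm (by linarith) h1
    rw [h6, zero_div] at key
    linarith

end Algebra

/-! ### Riemannian submanifolds of space forms -/

section Submanifold

variable {n m : ℕ}
  {M : Type*} [TopologicalSpace M] [ChartedSpace (EuclideanSpace ℝ (Fin n)) M]
  [Bundle.RiemannianBundle (fun x : M => TangentSpace (𝓡 n) x)]
  {N : Type*} [TopologicalSpace N] [ChartedSpace (EuclideanSpace ℝ (Fin m)) N]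
  [Bundle.RiemannianBundle (fun x : N => TangentSpace (𝓡 m) x)]
  {f : M → N} {p : M}

lemma finrank_tangentSpace (p : M) : Module.finrank ℝ (TangentSpace (𝓡 n) p) = n :=
  finrank_euclideanSpace_fin (𝕜 := ℝ) (n := n)

/-- An isometric differential is injective. Hence orthonormal normal families indexed by `Fin (m -
n)` are bases of the normal space. -/
lemma finrank_normalSpace (hf : IsIsometricImmersion n m f) (p : M) :
    Module.finrank ℝ (normalSpace n m f p) = m - n := by
  have hinj : Function.Injective (mfderiv (𝓡 n) (𝓡 m) f p).toLinearMap := by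
    rw [← LinearMap.ker_eq_bot, LinearMap.ker_eq_bot']
    intro u hu
    have h := hf.isometric p u u
    rw [show mfderiv (𝓡 n) (𝓡 m) f p u = 0 from hu, inner_zero_left] at h
    exact inner_self_eq_zero.1 h.symm
  have h1 := LinearMap.finrank_range_of_inj hinj
  have h2 := Submodule.finrank_add_finrank_orthogonal
    (LinearMap.range (mfderiv (𝓡 n) (𝓡 m) f p).toLinearMap)
  rw [h1, finrank_tangentSpace, finrank_tangentSpace] at h2
  rw [normalSpace]
  omega

lemma secondFundamentalForm_mem (u v : TangentSpace (𝓡 n) p) :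
    secondFundamentalForm n m f p u v ∈ normalSpace n m f p :=
  Submodule.starProjection_apply_mem _ _

lemma mem_normalSpace_iff (ν : TangentSpace (𝓡 m) (f p)) :
    ν ∈ normalSpace n m f p ↔
      ∀ w : TangentSpace (𝓡 n) p, ⟪mfderiv (𝓡 n) (𝓡 m) f p w, ν⟫_ℝ = 0 := by
  rw [normalSpace, Submodule.mem_orthogonal]
  constructor
  · exact fun h w => h _ ⟨w, rfl⟩
  · rintro h _ ⟨w, rfl⟩
    exact h w

lemma shapeOperator_of_isIdealForm {d : TangentSpace (𝓡 n) p} {a : TangentSpace (𝓡 m) (f p)}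
    (h : IsIdealForm (secondFundamentalForm n m f p) d a) (ν : TangentSpace (𝓡 m) (f p))
    (u : TangentSpace (𝓡 n) p) :
    shapeOperator n m f p ν u = ⟪a, ν⟫_ℝ • (u + ⟪u, d⟫_ℝ • d) := by
  refine ext_inner_right ℝ fun v => ?_
  rw [inner_shapeOperator, h, real_inner_smul_left, real_inner_smul_left, inner_add_left,
    real_inner_smul_left, real_inner_comm v d]
  ring

lemma isInvariantlyQuasiUmbilicalAt_of_isIdealForm (hf : IsIsometricImmersion n m f)
    {d : TangentSpace (𝓡 n) p} {a : TangentSpace (𝓡 m) (f p)} (hd : ‖d‖ = 1)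
    (h : IsIdealForm (secondFundamentalForm n m f p) d a) :
    IsInvariantlyQuasiUmbilicalAt n m f p := by
  let b := (stdOrthonormalBasis ℝ (normalSpace n m f p)).reindex
    (finCongr (finrank_normalSpace hf p))
  refine ⟨fun α => b α, d, b.orthonormal.comp_linearIsometry (normalSpace n m f p).subtypeₗᵢ,
    fun α => (b α).2, hd, fun α => ⟨⟪a, (b α : TangentSpace (𝓡 m) (f p))⟫_ℝ,
      2 * ⟪a, (b α : TangentSpace (𝓡 m) (f p))⟫_ℝ, ?_, fun u hu => ?_⟩⟩
  · rw [shapeOperator_of_isIdealForm h, real_inner_self_eq_norm_sq, hd, one_pow, one_smul,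
      ← two_smul ℝ d, smul_smul, mul_comm]
  · rw [shapeOperator_of_isIdealForm h, hu, zero_smul, add_zero]

/-- The condition `i + 1 = n` picks the last index, so the diagonal matrix is that of a(1 + e_l ⊗
e_l), and an operator is determined by its matrix. -/
lemma toMatrix_eq_diagonal_iff {V : Type*} [NormedAddCommGroup V] [InnerProductSpace ℝ V]
    (e : OrthonormalBasis (Fin n) ℝ V) (A : V →ₗ[ℝ] V) (a : ℝ) (l : Fin n) (hl : (l : ℕ) + 1 = n) :
    LinearMap.toMatrix e.toBasis e.toBasis A =
        (Matrix.diagonal fun i : Fin n => if (i : ℕ) + 1 = n then 2 * a else a) ↔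
      ∀ u, A u = a • (u + ⟪u, e l⟫_ℝ • e l) := by
  have hl' (i : Fin n) : (i : ℕ) + 1 = n ↔ i = l := by
    rw [Fin.ext_iff]; omega
  let B : V →ₗ[ℝ] V := a • (LinearMap.id + (innerₛₗ ℝ (e l)).smulRight (e l))
  have hB : LinearMap.toMatrix e.toBasis e.toBasis B =
      (Matrix.diagonal fun i : Fin n => if (i : ℕ) + 1 = n then 2 * a else a) := by
    ext i j
    have hon := orthonormal_iff_ite.1 e.orthonormal
    rw [LinearMap.toMatrix_apply, e.coe_toBasis, e.coe_toBasis_repr_apply, e.repr_apply_apply]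
    simp only [B, LinearMap.smul_apply, LinearMap.add_apply, LinearMap.id_apply,
      LinearMap.smulRight_apply, innerₛₗ_apply_apply, inner_smul_right, inner_add_right, hon,
      Matrix.diagonal_apply, hl']
    by_cases hij : i = j
    · subst hij
      by_cases hi : i = l
      · simp [hi]; ring
      · simp [hi]
    · by_cases hi : i = l
      · have : l ≠ j := hi ▸ hij
        simp [hi, this]
      · simp [hij, hi]
  rw [← hB, (LinearMap.toMatrix e.toBasis e.toBasis).injective.eq_iff, LinearMap.ext_iff]
  simp only [B, LinearMap.smul_apply, LinearMap.add_apply, LinearMap.id_apply,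
      LinearMap.smulRight_apply, innerₛₗ_apply_apply, real_inner_comm]

lemma hasCasoratiIdealShape_iff (hn : 2 ≤ n) (hf : IsIsometricImmersion n m f) :
    HasCasoratiIdealShape n m f p ↔
      ∃ d a, ‖d‖ = 1 ∧ IsIdealForm (secondFundamentalForm n m f p) d a := by
  classical
  let l : Fin n := ⟨n - 1, by omega⟩
  have hl : (l : ℕ) + 1 = n := by simp only [l]; omega
  have hcard : Module.finrank ℝ (normalSpace n m f p) = Fintype.card (Fin (m - n)) := by
    rw [finrank_normalSpace hf, Fintype.card_fin]
  constructor
  · rintro ⟨e, ξ, a, hξ, hξn, hA⟩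
    -- This is a times the first normal vector, written as a sum so that it is 0 when there are no
    -- normal directions.
    let a' : TangentSpace (𝓡 m) (f p) := ∑ α : Fin (m - n), if (α : ℕ) = 0 then a • ξ α else 0
    have ha'n : a' ∈ normalSpace n m f p := Submodule.sum_mem _ fun α _ => by
      split_ifs
      · exact Submodule.smul_mem _ _ (hξn α)
      · exact Submodule.zero_mem _
    have ha' (α : Fin (m - n)) : ⟪a', ξ α⟫_ℝ = if (α : ℕ) = 0 then a else 0 := by
      have hon := orthonormal_iff_ite.1 hξ
      simp only [a', sum_inner]
      rw [Finset.sum_eq_single α]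
      · split_ifs
        · rw [real_inner_smul_left, hon]; simp
        · simp
      · intro β _ hβ
        split_ifs
        · rw [real_inner_smul_left, hon]; simp [hβ]
        · simp
      · simp
    refine ⟨e l, a', e.orthonormal.1 l, fun u v => ?_⟩
    have hξ' : Orthonormal ℝ (fun α => (⟨ξ α, hξn α⟩ : normalSpace n m f p)) := by
      rw [orthonormal_iff_ite] at hξ ⊢
      exact hξ
    obtain ⟨b, hb⟩ := Orthonormal.exists_orthonormalBasis_extension_of_card_eq (𝕜 := ℝ) hcard
      (v := fun α => (⟨ξ α, hξn α⟩ : normalSpace n m f p)) (s := Set.univ)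
      (hξ'.comp Subtype.val Subtype.val_injective)
    have hmem : secondFundamentalForm n m f p u v - (⟪u, v⟫_ℝ + ⟪u, e l⟫_ℝ * ⟪v, e l⟫_ℝ) • a'
        ∈ normalSpace n m f p :=
      Submodule.sub_mem _ (secondFundamentalForm_mem u v) (Submodule.smul_mem _ _ ha'n)
    rw [← sub_eq_zero]
    -- Both sides are normal, so comparing inner products with the basis ξ, that is, comparing shape
    -- operators, suffices.
    have hz : (⟨_, hmem⟩ : normalSpace n m f p) = 0 := by
      refine InnerProductSpace.ext_inner_right_basis b.toBasis fun α => ?_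
      rw [b.coe_toBasis, hb α (Set.mem_univ α), inner_zero_left, Submodule.coe_inner,
        inner_sub_left, real_inner_smul_left, ha', ← inner_shapeOperator]
      have hAα := hA α
      split_ifs with h0
      · rw [if_pos h0, toMatrix_eq_diagonal_iff e _ a l hl] at hAα
        rw [hAα, real_inner_smul_left, inner_add_left, real_inner_smul_left, real_inner_comm v (e l)]
        ring
      · rw [if_neg h0, LinearEquiv.map_eq_zero_iff] at hAα
        simp [hAα]
    exact congrArg Subtype.val hz
  · rintro ⟨d, a', hd, h⟩
    have ha'n : a' ∈ normalSpace n m f p := by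
      have h1 : secondFundamentalForm n m f p d d = (2 : ℝ) • a' := by
        rw [h, real_inner_self_eq_norm_sq, hd]; norm_num
      have h2 := Submodule.smul_mem _ (2⁻¹ : ℝ) (secondFundamentalForm_mem (f := f) (m := m) d d)
      rwa [h1, inv_smul_smul₀ two_ne_zero] at h2
    obtain ⟨e, he⟩ := Orthonormal.exists_orthonormalBasis_extension_of_card_eq (𝕜 := ℝ)
      (ι := Fin n) (v := fun _ => d) (s := {l})
      (by rw [finrank_tangentSpace, Fintype.card_fin])
      (by
        refine ⟨fun _ => hd, fun i j hij => (hij (Subsingleton.elim i j)).elim⟩)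
    have hel : e l = d := he l rfl
    let w : normalSpace n m f p := ⟨a', ha'n⟩
    obtain ⟨b, hb⟩ : ∃ b : OrthonormalBasis (Fin (m - n)) ℝ (normalSpace n m f p),
        ∀ α, ⟪w, b α⟫_ℝ = if (α : ℕ) = 0 then ‖a'‖ else 0 := by
      -- If `w` is 0, any basis works; otherwise the unit vector along `w` is extended to a basis.
      -- The prescribed index 0 exists because the normal space is then nontrivial.
      by_cases h0 : w = 0
      · have : a' = 0 := congrArg Subtype.val h0
        exact ⟨(stdOrthonormalBasis ℝ (normalSpace n m f p)).reindex
          (finCongr (finrank_normalSpace hf p)), fun α => by simp [h0, this]⟩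
      · have hw : ‖w‖ ≠ 0 := norm_ne_zero_iff.2 h0
        obtain ⟨b, hb⟩ := Orthonormal.exists_orthonormalBasis_extension_of_card_eq (𝕜 := ℝ)
          (ι := Fin (m - n)) (v := fun _ => ‖w‖⁻¹ • w) (s := {α | (α : ℕ) = 0}) hcard
          (by
            refine ⟨fun _ => ?_, fun i j hij => (hij ?_).elim⟩
            · change ‖‖w‖⁻¹ • w‖ = 1
              rw [norm_smul, norm_inv, norm_norm, inv_mul_cancel₀ hw]
            · exact Subtype.ext (Fin.ext (i.2.trans j.2.symm)))
        have : Nontrivial (normalSpace n m f p) := ⟨⟨w, 0, h0⟩⟩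
        have hpos : 0 < m - n := by
          rw [← finrank_normalSpace hf p]; exact Module.finrank_pos
        have hw0 : w = ‖w‖ • b ⟨0, hpos⟩ := by
          rw [hb ⟨0, hpos⟩ rfl, smul_inv_smul₀ hw]
        refine ⟨b, fun α => ?_⟩
        rw [hw0, real_inner_smul_left, orthonormal_iff_ite.1 b.orthonormal]
        have : (⟨0, hpos⟩ : Fin (m - n)) = α ↔ (α : ℕ) = 0 := by
          rw [Fin.ext_iff]; exact eq_comm
        simp only [this, mul_ite, mul_one, mul_zero]
        rfl
    refine ⟨e, fun α => b α, ‖a'‖, b.orthonormal.comp_linearIsometry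
      (normalSpace n m f p).subtypeₗᵢ, fun α => (b α).2, fun α => ?_⟩
    have hbα : ⟪a', (b α : TangentSpace (𝓡 m) (f p))⟫_ℝ = if (α : ℕ) = 0 then ‖a'‖ else 0 := hb α
    have hs := shapeOperator_of_isIdealForm h (b α)
    rw [hbα] at hs
    split_ifs with h0
    · rw [toMatrix_eq_diagonal_iff e _ _ l hl]
      intro u
      rw [hs, hel, if_pos h0]
    · rw [LinearEquiv.map_eq_zero_iff]
      ext u
      rw [hs, if_neg h0, zero_smul, LinearMap.zero_apply]

variable [IsManifold (𝓡 n) ∞ M] [IsManifold (𝓡 m) ∞ N]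

lemma chartMetric_localRep_self (f : M → N) (p : M) (u v : TangentSpace (𝓡 m) (f p)) :
    chartMetric m (f p) (localRep n m f p (extChartAt (𝓡 n) p p)) u v = ⟪u, v⟫_ℝ := by
  rw [localRep_self]
  exact chartMetric_self (f p) u v

lemma IsIsometricImmersion.fderiv_localRep (hf : IsIsometricImmersion n m f) (p : M)
    (u : TangentSpace (𝓡 n) p) :
    fderiv ℝ (localRep n m f p) (extChartAt (𝓡 n) p p) u = mfderiv (𝓡 n) (𝓡 m) f p u :=
  congrArg (fun L : EuclideanSpace ℝ (Fin n) →L[ℝ] EuclideanSpace ℝ (Fin m) => L u)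
    (Casorati.fderiv_localRep ((hf.smooth p).mdifferentiableAt (by simp)))

variable [IsContMDiffRiemannianBundle (𝓡 n) ∞ (EuclideanSpace ℝ (Fin n))
      (fun x : M => TangentSpace (𝓡 n) x)]
  [IsContMDiffRiemannianBundle (𝓡 m) ∞ (EuclideanSpace ℝ (Fin m))
      (fun x : N => TangentSpace (𝓡 m) x)]

lemma secondFundamentalForm_symm (hf : IsIsometricImmersion n m f)
    (u v : TangentSpace (𝓡 n) p) :
    secondFundamentalForm n m f p u v = secondFundamentalForm n m f p v u := by
  have h := isIsometricAt_localRep hf p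
  exact congrArg (normalSpace n m f p).starProjection
    (hessianAlong_symm h.target h.contDiffAt_two u v)

/-- By `inner_hessianAlong` the tangential part of the Hessian is DF Γ, so projecting to the normal
space subtracts it. This matches σ with the terms of the Gauss equation. -/
lemma secondFundamentalForm_eq (hf : IsIsometricImmersion n m f) (u v : TangentSpace (𝓡 n) p) :
    secondFundamentalForm n m f p u v =
      hessianAlong (chartMetric m (f p)) (localRep n m f p) (extChartAt (𝓡 n) p p) u v
      - fderiv ℝ (localRep n m f p) (extChartAt (𝓡 n) p p)
          (christoffel (chartMetric n p) (extChartAt (𝓡 n) p p) u v) := by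
  have h := isIsometricAt_localRep hf p
  let H : TangentSpace (𝓡 m) (f p) :=
    hessianAlong (chartMetric m (f p)) (localRep n m f p) (extChartAt (𝓡 n) p p) u v
  let Γ : TangentSpace (𝓡 n) p := christoffel (chartMetric n p) (extChartAt (𝓡 n) p p) u v
  have hmem : H - mfderiv (𝓡 n) (𝓡 m) f p Γ ∈ normalSpace n m f p := by
    rw [mem_normalSpace_iff]
    intro w
    rw [real_inner_comm, inner_sub_left, hf.isometric, sub_eq_zero]
    have h1 : chartMetric m (f p) (localRep n m f p (extChartAt (𝓡 n) p p)) H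
        (mfderiv (𝓡 n) (𝓡 m) f p w) = chartMetric n p (extChartAt (𝓡 n) p p) Γ w := by
      exact (congrArg _ (hf.fderiv_localRep p w).symm).trans (h.inner_hessianAlong u v w)
    exact (chartMetric_localRep_self f p _ _).symm.trans (h1.trans (chartMetric_self p Γ w))
  have hperp : mfderiv (𝓡 n) (𝓡 m) f p Γ ∈ (normalSpace n m f p)ᗮ := by
    rw [normalSpace, Submodule.orthogonal_orthogonal]
    exact ⟨Γ, rfl⟩
  have e : secondFundamentalForm n m f p u v = H - mfderiv (𝓡 n) (𝓡 m) f p Γ :=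
    Submodule.eq_starProjection_of_mem_orthogonal hmem (by
      show H - (H - mfderiv (𝓡 n) (𝓡 m) f p Γ) ∈ _
      rwa [sub_sub_cancel])
  rw [e, ← hf.fderiv_localRep]
  rfl

lemma IsRealSpaceForm.curvature_localRep {c : ℝ} (hN : IsRealSpaceForm m N c) (f : M → N) (p : M)
    (u v : EuclideanSpace ℝ (Fin m)) :
    let G := chartMetric m (f p)
    let y := localRep n m f p (extChartAt (𝓡 n) p p)
    G y u u = 1 → G y v v = 1 → G y u v = 0 → G y (curvature G y u v v) u = c := by
  intro G y
  have hy : y = extChartAt (𝓡 m) (f p) (f p) := localRep_self f p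
  have hG (u v : EuclideanSpace ℝ (Fin m)) :
      G y u v = inner ℝ (E := TangentSpace (𝓡 m) (f p)) u v := chartMetric_localRep_self f p u v
  intro hu hv huv
  rw [hG] at hu hv huv
  rw [hG, hy]
  have hnorm (u : TangentSpace (𝓡 m) (f p)) (hu : ⟪u, u⟫_ℝ = 1) : ‖u‖ = 1 := by
    rwa [real_inner_self_eq_norm_sq, pow_eq_one_iff_of_nonneg (norm_nonneg u) two_ne_zero] at hu
  exact hN (f p) u v (hnorm u hu) (hnorm v hv) huv

lemma inner_normalHessian (hf : IsIsometricImmersion n m f) (u v : TangentSpace (𝓡 n) p)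
    (ν : TangentSpace (𝓡 m) (f p)) :
    chartMetric m (f p) (localRep n m f p (extChartAt (𝓡 n) p p))
      (hessianAlong (chartMetric m (f p)) (localRep n m f p) (extChartAt (𝓡 n) p p) u v
        - fderiv ℝ (localRep n m f p) (extChartAt (𝓡 n) p p)
          (christoffel (chartMetric n p) (extChartAt (𝓡 n) p p) u v)) ν
      = ⟪secondFundamentalForm n m f p u v, ν⟫_ℝ := by
  rw [secondFundamentalForm_eq hf]
  exact chartMetric_localRep_self f p _ ν

/-- The Gauss equation for sectional curvatures of submanifolds of space forms. -/
lemma sectional_eq {c : ℝ} (hN : IsRealSpaceForm m N c) (hf : IsIsometricImmersion n m f)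
    {u v : TangentSpace (𝓡 n) p} (hu : ‖u‖ = 1) (hv : ‖v‖ = 1) (huv : ⟪u, v⟫_ℝ = 0) :
    sectional n p u v = c + ⟪secondFundamentalForm n m f p u u, secondFundamentalForm n m f p v v⟫_ℝ
      - ‖secondFundamentalForm n m f p u v‖ ^ 2 := by
  have h := isIsometricAt_localRep hf p
  have hg (u v : TangentSpace (𝓡 n) p) :
      chartMetric n p (extChartAt (𝓡 n) p p) u v = ⟪u, v⟫_ℝ := chartMetric_self p u v
  have hc := hN.curvature_localRep f p (fderiv ℝ (localRep n m f p) (extChartAt (𝓡 n) p p) u)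
    (fderiv ℝ (localRep n m f p) (extChartAt (𝓡 n) p p) v)
    ((h.isometric_self u u).trans ((hg u u).trans (by rw [real_inner_self_eq_norm_sq, hu, one_pow])))
    ((h.isometric_self v v).trans ((hg v v).trans (by rw [real_inner_self_eq_norm_sq, hv, one_pow])))
    ((h.isometric_self u v).trans ((hg u v).trans huv))
  have hs (a b a' b' : TangentSpace (𝓡 n) p) := (inner_normalHessian hf a b
    (secondFundamentalForm n m f p a' b')).symm.trans
      (congrArg _ (secondFundamentalForm_eq hf a' b'))
  have hR : sectional n p u v = chartMetric n p (extChartAt (𝓡 n) p p)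
    (curvature (chartMetric n p) (extChartAt (𝓡 n) p p) u v v) u := (hg _ _).symm
  have hG := (h.gauss u v v u).symm.trans hc
  have e1 := hs v v u u
  have e2 := hs u v v u
  rw [secondFundamentalForm_symm hf v u, real_inner_self_eq_norm_sq] at e2
  rw [real_inner_comm] at e1
  rw [hR]
  linarith

lemma two_mul_sum_lt {k : ℕ} (t : Fin k → Fin k → ℝ) (ht : ∀ i j, t i j = t j i) :
    2 * (∑ i, ∑ j, if i < j then t i j else 0) = ∑ i, ∑ j, t i j - ∑ i, t i i := by
  have h1 (i j : Fin k) : t i j = (if i < j then t i j else 0) + (if j < i then t j i else 0)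
      + if i = j then t i j else 0 := by
    rcases lt_trichotomy i j with h | h | h
    · simp [h, h.not_gt, h.ne]
    · simp [h]
    · simp [h, h.not_gt, h.ne', ht i j]
  have h2 : ∑ i, ∑ j, t i j = ∑ i, ∑ j, (if i < j then t i j else 0)
      + ∑ i, ∑ j, (if j < i then t j i else 0) + ∑ i, t i i := by
    conv_lhs => enter [2, i, 2, j]; rw [h1]
    simp [Finset.sum_add_distrib]
  rw [h2, Finset.sum_comm (f := fun i j => if j < i then t j i else 0)]
  ring

lemma normalizedScalarCurvature_eq (hn : 2 ≤ n) {c : ℝ} (hN : IsRealSpaceForm m N c)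
    (hf : IsIsometricImmersion n m f) (p : M) :
    let e := stdOrthonormalBasis ℝ (TangentSpace (𝓡 n) p)
    let σ := secondFundamentalForm n m f p
    normalizedScalarCurvature n p =
      (‖∑ i, σ (e i) (e i)‖ ^ 2 - ∑ i, ∑ j, ‖σ (e i) (e j)‖ ^ 2) / ((n : ℝ) * (n - 1)) + c := by
  intro e σ
  have hsec (i j) (hij : i ≠ j) : sectional n p (e i) (e j)
      = c + ⟪σ (e i) (e i), σ (e j) (e j)⟫_ℝ - ‖σ (e i) (e j)‖ ^ 2 :=
    sectional_eq hN hf (e.orthonormal.1 i) (e.orthonormal.1 j) (e.orthonormal.2 hij)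
  have hscal : 2 * scalarCurvature n p = ‖∑ i, σ (e i) (e i)‖ ^ 2
      - ∑ i, ∑ j, ‖σ (e i) (e j)‖ ^ 2 + (n : ℝ) * (n - 1) * c := by
    have h1 : scalarCurvature n p = ∑ i, ∑ j, if i < j then
        c + ⟪σ (e i) (e i), σ (e j) (e j)⟫_ℝ - ‖σ (e i) (e j)‖ ^ 2 else 0 :=
      Finset.sum_congr rfl fun i _ => Finset.sum_congr rfl fun j _ => by
        split_ifs with hij
        · exact hsec i j hij.ne
        · rfl
    have hfin : (Module.finrank ℝ (TangentSpace (𝓡 n) p) : ℝ) = n := by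
      rw [finrank_tangentSpace]
    -- The summand is symmetric and its diagonal terms equal c, so the full sum minus the diagonal
    -- contributes (n² − n)c.
    rw [h1, two_mul_sum_lt _ fun i j => by
      rw [real_inner_comm, secondFundamentalForm_symm hf (e i) (e j)]]
    simp only [real_inner_self_eq_norm_sq, add_sub_cancel_right, Finset.sum_sub_distrib,
      Finset.sum_add_distrib, ← inner_sum, ← sum_inner, Finset.sum_const, Finset.card_univ,
      Fintype.card_fin, nsmul_eq_mul, hfin]
    ring
  have hn2 : (2 : ℝ) ≤ n := by exact_mod_cast hn
  have h1 : (n : ℝ) - 1 ≠ 0 := by linarith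
  have h2 : (n : ℝ) ≠ 0 := by linarith
  rw [normalizedScalarCurvature, div_mul_eq_mul_div, hscal]
  field_simp

lemma hasTrivialNormalConnection_of_isIdealForm {c : ℝ} (hN : IsRealSpaceForm m N c)
    (hf : IsIsometricImmersion n m f)
    (h : ∀ p : M, ∃ d a, ‖d‖ = 1 ∧ IsIdealForm (secondFundamentalForm n m f p) d a) :
    HasTrivialNormalConnection n m f := by
  intro p u v V hV hVn
  obtain ⟨d, a, -, ha⟩ := h p
  have hi := isIsometricAt_localRep hf p
  refine hi.normalCurvature_eq_zero (c := c) ?_ ?_ d a ?_ (hV.of_le ENat.LEInfty.out) hVn u v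
  · rw [localRep_self]
    exact chartMetric_self_pos (f p)
  · exact hN.curvature_localRep f p
  · intro ν u w hν
    have hG := inner_normalHessian hf (p := p) u w ν
    have hg (u v : TangentSpace (𝓡 n) p) :
      chartMetric n p (extChartAt (𝓡 n) p p) u v = ⟪u, v⟫_ℝ := chartMetric_self p u v
    rw [map_sub, sub_apply, hν, sub_zero, ha u w] at hG
    refine hG.trans ((real_inner_smul_left _ _ _).trans
      (congrArg₂ _ ?_ (chartMetric_localRep_self f p a ν).symm))
    exact congrArg₂ _ (hg u w).symm (congrArg₂ _ (hg u d).symm (hg w d).symm)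

end Submanifold

end Casorati

/-! ### The theorem. -/

theorem mainTheorem8 {n m : ℕ} (hn : 2 ≤ n)
    {M : Type*} [TopologicalSpace M] [ChartedSpace (EuclideanSpace ℝ (Fin n)) M]
    [IsManifold (𝓡 n) ∞ M]
    [Bundle.RiemannianBundle (fun x : M => TangentSpace (𝓡 n) x)]
    [IsContMDiffRiemannianBundle (𝓡 n) ∞ (EuclideanSpace ℝ (Fin n))
      (fun x : M => TangentSpace (𝓡 n) x)]
    {N : Type*} [TopologicalSpace N] [ChartedSpace (EuclideanSpace ℝ (Fin m)) N]
    [IsManifold (𝓡 m) ∞ N]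
    [Bundle.RiemannianBundle (fun x : N => TangentSpace (𝓡 m) x)]
    [IsContMDiffRiemannianBundle (𝓡 m) ∞ (EuclideanSpace ℝ (Fin m))
      (fun x : N => TangentSpace (𝓡 m) x)]
    (c : ℝ) (hN : Casorati.IsRealSpaceForm m N c)
    (f : M → N) (hf : Casorati.IsIsometricImmersion n m f) :
    (∀ p : M, Casorati.normalizedScalarCurvature n p ≤ Casorati.deltaCasorati n m f p + c) ∧
    ((∀ p : M, Casorati.normalizedScalarCurvature n p = Casorati.deltaCasorati n m f p + c) ↔
      (∀ p : M, Casorati.IsInvariantlyQuasiUmbilicalAt n m f p) ∧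
        Casorati.HasTrivialNormalConnection n m f ∧
        ∀ p : M, Casorati.HasCasoratiIdealShape n m f p) := by
  have key (p : M) := Casorati.casorati_inequality
    (σ := Casorati.secondFundamentalForm n m f p) (Casorati.secondFundamentalForm_symm hf) hn
    (Casorati.finrank_tangentSpace p) (stdOrthonormalBasis ℝ (TangentSpace (𝓡 n) p))
  have hτ (p : M) := Casorati.normalizedScalarCurvature_eq hn hN hf p
  have heq (p : M) : Casorati.normalizedScalarCurvature n p = Casorati.deltaCasorati n m f p + c ↔
      ∃ d a, ‖d‖ = 1 ∧ Casorati.IsIdealForm (Casorati.secondFundamentalForm n m f p) d a := by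
    rw [hτ p, add_left_inj]
    exact (key p).2
  refine ⟨fun p => ?_, ?_⟩
  · rw [hτ p, add_le_add_iff_right]
    exact (key p).1
  · simp only [heq, Casorati.hasCasoratiIdealShape_iff hn hf]
    -- The shape condition alone is equivalent to equality; quasi-umbilicity and flatness of the
    -- normal connection follow from it.
    refine ⟨fun h => ⟨fun p => ?_, Casorati.hasTrivialNormalConnection_of_isIdealForm hN hf h, h⟩,
      fun h => h.2.2⟩
    obtain ⟨d, a, hd, ha⟩ := h p
    exact Casorati.isInvariantlyQuasiUmbilicalAt_of_isIdealForm hf hd ha
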